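/- For a finite multigraph $G=(V,E)$ and $\beta>0$, the arboreal gas $\mathbb{A}_\beta^G$ is the probability measure on $\{0,1\}^E$ supported on forests (configurations whose open edges contain no cycle; loops and pairs of parallel edges count as cycles) which gives a forest $\eta$ with $|\eta|$ edges probability $\beta^{|\eta|}/Z_\beta$, where $Z_\beta$ is the normalising constant. For $p\in[0,1]$, $\mathbb{P}_p^G$ denotes Bernoulli bond percolation on $G$ with edge probability $p$. Let $T$ be a $k$-regular tree with $k\ge 3$. An exhaustion of $T$ is an increasing sequence $(V_n)$ of finite connected vertex sets whose union contains every vertex. The graph $G_n$ induced by $V_n$ with wired boundary conditions is the finite multigraph obtained from the subgraph of $T$ induced by the union of $V_n$ with its neighbours in $T$ by merging these neighbours to a single vertex $\partial_n$; its edges are identified with edges of $T$. Fix a vertex $o$ of $T$, let $d$ be the graph distance on $T$, and for each edge $e$ of $T$ let $e^-,e^+$ be its endpoints with $d(o,e^-)<d(o,e^+)$. **Theorem.** Let $k\ge 3$, let $T$ be a $k$-regular tree and let $\beta>0$. 1. There is a probability measure $\mathbb{W}_\beta^T$ on $\{0,1\}^{E(T)}$ such that, for every exhaustion of $T$, the associated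 measures $\mathbb{A}_\beta^{G_n}$ converge weakly to $\mathbb{W}_\beta^T$ as $n\to\infty$ (so the limit does not depend on the exhaustion), and $\mathbb{W}_\beta^T$ is invariant under every graph automorphism of $T$. 2. If $\beta\le\frac1{k-2}$, then $\mathbb{W}_\beta^T=\mathbb{P}_{p_\beta}^T$, where $p_\beta=\frac{\beta}{\beta+1}$. 3. If $\beta\ge\frac1{k-2}$, then $\mathbb{W}_\beta^T$ is the law of the configuration $\omega$ produced by the following procedure, for any choice of $o$, in which the random objects in (a), (b) and (d) are independent: (a) sample $\omega_0$ on the edges of $T$ according to $\mathbb{P}_{p_c}^T$, where $p_c=\frac1{k-1}$; (b) sample a random set $\eta$ of vertices of $T$, each vertex $v$ being included independently, with probability $\frac{\beta(k-2)k-k}{\beta(k-2)k-1}$ if $v=o$ and $\frac{\beta(k-2)-1}{\beta(k-2)}$ if $v\ne o$; (c) let $U$ be the set of $v\in\eta$ such that $v=o$ or there is an edge $e\notin\omega_0$ of $T$ with $e^+=v$; (d) for each vertex $v$, independently choose a neighbour $s(v)$ of $v$ with $d(o,s(v))>d(o,v)$ uniformly at random, and let $\gamma(v)$ be the set of edges of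 the path $v,s(v),s(s(v)),\dots$; (e) set $\omega=\omega_0\cup\bigcup_{v\in U}\gamma(v)$. -/

import Mathlib

open MeasureTheory ProbabilityTheory Filter Topology

noncomputable section

/-! ### The arboreal gas on a finite multigraph -/

/-- The set `F` of edges contains a cycle of the multigraph `G`: cyclically arranged distinct
vertices `v 0, …, v m` and distinct edges `e 0, …, e m` in `F`, where `e i` joins `v i` to
`v (i + 1)` (indices modulo `m + 1`). A loop is a cycle (`m = 0`), and so is a pair of parallel
edges (`m = 1`). -/
def Graph.ContainsCycle {α ε : Type*} (G : Graph α ε) (F : Set ε) : Prop :=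
  ∃ (m : ℕ) (v : Fin (m + 1) → α) (e : Fin (m + 1) → ε),
    Function.Injective v ∧ Function.Injective e ∧
      ∀ i, e i ∈ F ∧ G.IsLink (e i) (v i) (v (i + 1))

/-- The spanning subgraph of `G` with edge set `F` is a forest. -/
def Graph.IsForest {α ε : Type*} (G : Graph α ε) (F : Set ε) : Prop :=
  F ⊆ G.edgeSet ∧ ¬ G.ContainsCycle F

open Classical in
/-- The finite set of all forests of a multigraph with finitely many edges. -/
def Graph.forests {α ε : Type*} (G : Graph α ε) (hG : G.edgeSet.Finite) : Finset (Finset ε) :=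
  hG.toFinset.powerset.filter fun F => G.IsForest (F : Set ε)

/-- The normalising constant `Z_β` of the arboreal gas. -/
def Graph.arborealPartition {α ε : Type*} (G : Graph α ε) (hG : G.edgeSet.Finite) (β : ℝ) : ℝ :=
  ∑ F ∈ G.forests hG, β ^ F.card

open Classical in
theorem Graph.empty_mem_forests {α ε : Type*} (G : Graph α ε) (hG : G.edgeSet.Finite) :
    ∅ ∈ G.forests hG := by
  refine Finset.mem_filter.2 ⟨by simp, by simp, ?_⟩
  rintro ⟨m, v, e, -, -, h⟩
  simpa using (h 0).1

theorem Graph.arborealPartition_pos {α ε : Type*} (G : Graph α ε) (hG : G.edgeSet.Finite)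
    {β : ℝ} (hβ : 0 < β) : 0 < G.arborealPartition hG β :=
  Finset.sum_pos (fun F _ => pow_pos hβ F.card) ⟨∅, G.empty_mem_forests hG⟩

open Classical in
/-- The arboreal gas of parameter `β` on a multigraph `G` with finitely many edges, as a measure
on configurations: the configuration `η` which is open exactly on the forest `F` has mass
`β ^ |F| / Z_β`. Configurations of the edges of `G` are regarded as configurations on the ambient
edge type `ε` that are closed (`false`) outside `E(G)`. -/
def Graph.arborealMeasure {α ε : Type*} (G : Graph α ε) (hG : G.edgeSet.Finite) (β : ℝ) :
    Measure (ε → Bool) :=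
  ∑ F ∈ G.forests hG, ENNReal.ofReal (β ^ F.card / G.arborealPartition hG β) •
    Measure.dirac (fun e => decide (e ∈ F))

/-- The arboreal gas `𝔸_β^G` as a probability measure. -/
def Graph.arborealGas {α ε : Type*} (G : Graph α ε) (hG : G.edgeSet.Finite) (β : ℝ)
    (hβ : 0 < β) : ProbabilityMeasure (ε → Bool) :=
  ⟨G.arborealMeasure hG β, ⟨by
    have hZ := G.arborealPartition_pos hG hβ
    simp only [Graph.arborealMeasure, Measure.coe_finsetSum, Finset.sum_apply, Measure.smul_apply,
      measure_univ, smul_eq_mul, mul_one]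
    rw [← ENNReal.ofReal_sum_of_nonneg (fun F _ => by positivity), ← Finset.sum_div]
    change ENNReal.ofReal (G.arborealPartition hG β / G.arborealPartition hG β) = 1
    rw [div_self hZ.ne', ENNReal.ofReal_one]⟩⟩

/-! ### Wired boundary conditions -/

/-- Bond configurations on `T`; `true` means open. -/
abbrev BondConfig {V : Type*} (T : SimpleGraph V) : Type _ := T.edgeSet → Bool

/-- The union of `S` with its neighbours. -/
def withNeighbours {V : Type*} (T : SimpleGraph V) (S : Finset V) : Set V :=
  {v | v ∈ S ∨ ∃ u ∈ S, T.Adj u v}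

/-- The subgraph of `T` induced by `W`, as a multigraph whose edges are edges of `T`. -/
def inducedMultigraph {V : Type*} (T : SimpleGraph V) (W : Set V) : Graph V T.edgeSet where
  vertexSet := W
  IsLink e x y := (e : Sym2 V) = s(x, y) ∧ x ∈ W ∧ y ∈ W
  isLink_symm := fun _ _ => ⟨fun _ _ h => ⟨h.1.trans Sym2.eq_swap, h.2.2, h.2.1⟩⟩
  eq_or_eq_of_isLink_of_isLink := by
    rintro e x y v w ⟨h, -, -⟩ ⟨h', -, -⟩
    have := Sym2.eq_iff.1 (h.symm.trans h')
    tauto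
  left_mem_of_isLink := fun _ _ _ h => h.2.1

open Classical in
/-- The finite multigraph obtained from the subgraph of `T` induced by the union of `S` with its
neighbours by merging all these neighbours to a single vertex `∂ = none`. Every edge keeps its
identity as an edge of `T`. -/
def wiredGraph {V : Type*} (T : SimpleGraph V) (S : Finset V) : Graph (Option V) T.edgeSet :=
  (inducedMultigraph T (withNeighbours T S)).map fun v => if v ∈ S then some v else none

theorem finite_edgeSet_wiredGraph {V : Type*} (T : SimpleGraph V) [T.LocallyFinite]
    (S : Finset V) : (wiredGraph T S).edgeSet.Finite := by
  have hW : (withNeighbours T S).Finite := by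
    have : withNeighbours T S = (S : Set V) ∪ ⋃ u ∈ S, T.neighborSet u := by
      ext v; simp [withNeighbours]
    rw [this]
    exact S.finite_toSet.union (S.finite_toSet.biUnion fun u _ => Set.toFinite _)
  refine Set.Finite.of_finite_image (f := Subtype.val) ?_ Subtype.val_injective.injOn
  refine ((hW.prod hW).image fun p => s(p.1, p.2)).subset ?_
  rintro _ ⟨e, he, rfl⟩
  obtain ⟨x, y, h, hx, hy⟩ := ((inducedMultigraph T _).edge_mem_iff_exists_isLink e).1 he
  exact ⟨(x, y), ⟨hx, hy⟩, h.symm⟩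

/-- The arboreal gas on the graph induced by `S` with wired boundary conditions. -/
def wiredArborealGas {V : Type*} (T : SimpleGraph V) [T.LocallyFinite] (S : Finset V) (β : ℝ)
    (hβ : 0 < β) : ProbabilityMeasure (BondConfig T) :=
  (wiredGraph T S).arborealGas (finite_edgeSet_wiredGraph T S) β hβ

/-- A growing sequence of finite connected sets of vertices whose union contains every vertex. -/
structure IsExhaustion {V : Type*} (T : SimpleGraph V) (S : ℕ → Finset V) : Prop where
  monotone : Monotone S
  connected : ∀ n, (T.induce (S n : Set V)).Connected
  exhausts : ∀ v, ∃ n, v ∈ S n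

/-- A locally finite tree has countably many edges; this makes the Borel and the product
σ-algebra on bond configurations agree, so that weak convergence makes sense. -/
instance countable_edgeSet {V : Type*} (T : SimpleGraph V) [T.LocallyFinite]
    [hT : Fact T.IsTree] : Countable T.edgeSet := by
  obtain ⟨o⟩ := hT.out.connected.nonempty
  let L : ℕ → Set V := fun n => n.rec {o} fun _ A => ⋃ u ∈ A, T.neighborSet u
  have hL : ∀ n, (L n).Countable := by
    intro n
    induction n with
    | zero => exact Set.countable_singleton o
    | succ n ih => exact ih.biUnion fun u _ => (Set.toFinite _).countable
  have hcover : ∀ v, v ∈ ⋃ n, L n := by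
    intro v
    have h := (T.reachable_iff_reflTransGen o v).1 (hT.out.connected.preconnected o v)
    induction h with
    | refl => exact Set.mem_iUnion.2 ⟨0, rfl⟩
    | tail _ hbc ih =>
      obtain ⟨n, hn⟩ := Set.mem_iUnion.1 ih
      exact Set.mem_iUnion.2 ⟨n + 1, Set.mem_biUnion hn hbc⟩
  have hV : Countable V := Set.countable_univ_iff.1
    ((Set.countable_iUnion hL).mono fun v _ => hcover v)
  have : Countable (Sym2 V) := Quot.mk_surjective.countable
  infer_instance

/-! ### Bond percolation -/

/-- Bond percolation `ℙ_p^T`: every edge is open independently with probability `p`. -/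
def bondPercolation {V : Type*} (T : SimpleGraph V) (p : unitInterval) : Measure (BondConfig T) :=
  Measure.infinitePi fun _ => bernoulliMeasure true false p

/-- `p_β = β / (β + 1)`. -/
def pArboreal (β : ℝ) (hβ : 0 < β) : unitInterval :=
  ⟨β / (β + 1), by positivity, (div_le_one (by positivity)).2 (by linarith)⟩

/-- `p_c = 1 / (k - 1)`. -/
def pCritical (k : ℕ) (hk : 3 ≤ k) : unitInterval :=
  ⟨1 / ((k : ℝ) - 1), by
    have hk' : (3 : ℝ) ≤ k := by exact_mod_cast hk
    exact ⟨div_nonneg zero_le_one (by linarith), (div_le_one (by linarith)).2 (by linarith)⟩⟩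

/-! ### The sampling procedure -/

theorem one_le_mul_of_supercritical {k : ℕ} {β : ℝ} (hk : 3 ≤ k)
    (hβ : 1 / ((k : ℝ) - 2) ≤ β) : 1 ≤ β * ((k : ℝ) - 2) := by
  have hk' : (3 : ℝ) ≤ k := by exact_mod_cast hk
  exact (div_le_iff₀ (by linarith)).1 hβ

/-- Probability `(β (k - 2) k - k) / (β (k - 2) k - 1)` that the root is in `η`. -/
def rootProb (k : ℕ) (β : ℝ) (hk : 3 ≤ k) (hβ : 1 / ((k : ℝ) - 2) ≤ β) : unitInterval :=
  ⟨(β * ((k : ℝ) - 2) * k - k) / (β * ((k : ℝ) - 2) * k - 1), by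
    have hk' : (3 : ℝ) ≤ k := by exact_mod_cast hk
    have h := one_le_mul_of_supercritical hk hβ
    have h1 : (0 : ℝ) ≤ β * ((k : ℝ) - 2) * k - k := by nlinarith
    have h2 : (0 : ℝ) < β * ((k : ℝ) - 2) * k - 1 := by nlinarith
    exact ⟨div_nonneg h1 h2.le, (div_le_one h2).2 (by linarith)⟩⟩

/-- Probability `(β (k - 2) - 1) / (β (k - 2))` that a given non-root vertex is in `η`. -/
def nonrootProb (k : ℕ) (β : ℝ) (hk : 3 ≤ k) (hβ : 1 / ((k : ℝ) - 2) ≤ β) : unitInterval :=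
  ⟨(β * ((k : ℝ) - 2) - 1) / (β * ((k : ℝ) - 2)), by
    have h := one_le_mul_of_supercritical hk hβ
    exact ⟨div_nonneg (by linarith) (by linarith), (div_le_one (by linarith)).2 (by linarith)⟩⟩

/-- The neighbours of `v` that are further from `o` than `v` is. -/
def children {V : Type*} (T : SimpleGraph V) (o v : V) : Set V :=
  {u | T.Adj v u ∧ T.dist o v < T.dist o u}

/-- The set `U` of starting points: vertices `v ∈ η` such that `v = o` or there is an edge
`e ∉ ω₀` with `e⁺ = v` (here `e = {u, v}`, `u = e⁻`). -/
def startVertices {V : Type*} (T : SimpleGraph V) (o : V) (ω₀ : BondConfig T) (η : V → Bool) :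
    Set V :=
  {v | η v = true ∧
    (v = o ∨ ∃ (u : V) (h : T.Adj u v), T.dist o u < T.dist o v ∧ ω₀ ⟨s(u, v), h⟩ = false)}

/-- The set `γ(v)` of edges in the path `v, s(v), s(s(v)), …`. -/
def pathEdges {V : Type*} (T : SimpleGraph V) (s : V → V) (v : V) : Set T.edgeSet :=
  {e | ∃ n : ℕ, (e : Sym2 V) = s(s^[n] v, s^[n + 1] v)}

open Classical in
/-- The configuration `ω = ω₀ ∪ ⋃_{v ∈ U} γ(v)`. -/
def superposition {V : Type*} (T : SimpleGraph V) (o : V) (ω₀ : BondConfig T) (η : V → Bool)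
    (s : V → V) : BondConfig T :=
  fun e => decide (ω₀ e = true ∨ ∃ v ∈ startVertices T o ω₀ η, e ∈ pathEdges T s v)

open Classical in
/-- The law of `ω = ω₀ ∪ ⋃_{v ∈ U} γ(v)` when `ω₀`, `η` and `s` are independent, `ω₀` is critical
bond percolation, the variables `η v` are independent with the given inclusion probabilities, and
the `s v` are independent and uniformly distributed on the children of `v`. -/
def sampledLaw {V : Type*} (T : SimpleGraph V) (o : V) (k : ℕ) (β : ℝ) (hk : 3 ≤ k)
    (hβ : 1 / ((k : ℝ) - 2) ≤ β) : Measure (BondConfig T) :=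
  letI : MeasurableSpace V := ⊤
  Measure.map (fun x : BondConfig T × (V → Bool) × (V → V) => superposition T o x.1 x.2.1 x.2.2)
    ((bondPercolation T (pCritical k hk)).prod
      ((Measure.infinitePi fun v : V =>
          bernoulliMeasure true false
            (if v = o then rootProb k β hk hβ else nonrootProb k β hk hβ)).prod
        (Measure.infinitePi fun v : V => uniformOn (children T o v))))

/-- A graph automorphism acts on bond configurations by transporting open edges. -/
def relabel {V : Type*} {T : SimpleGraph V} (φ : T ≃g T) (ω : BondConfig T) : BondConfig T :=
  fun e => ω (φ.symm.mapEdgeSet e)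

end

/-!
The tree is rooted at `o`. The configuration `ω = ω₀ ∪ ⋃ γ(v)` of the sampling procedure makes sense
for arbitrary edge probabilities, vertex probabilities and laws of the chosen children. Whether an
edge is open, and whether its further endpoint lies on one of the paths `γ(v)` (a "trail"), depends
only on the state of its nearer endpoint and on independent local variables. So the probability of a
configuration `G` on the edges below a finite set `S`, jointly with the set `τ` of vertices on trails,
is a product of transition weights over the vertices of `S` (`seedLaw_real_agree`).

On a finite set `S` the wired arboreal gas itself is such a superposition, with inhomogeneous
parameters. A set of edges is a forest of the wired graph if and only if every vertex has at most one
child through which it is connected to the boundary (`isForest_wiredGraph_iff`); the trails are the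
connections to the boundary. If `q v` is the ratio of the weights of the forests below `v` in which
`v` is, respectively is not, connected to the boundary, then `q v` is the sum over the children `u` of
`v` of the exit odds `φ u = β q u / (1 + β + q u)`, where `φ u = β` for `u` outside `S`. With edge
probabilities `β / (1 + β + q)`, vertex probabilities `q / (1 + q)` and children chosen with
probability `φ u / q v`, the product of the transition weights telescopes to a multiple of `β ^ |G|`
if `G` is a forest and `τ` is the set of vertices connected to the boundary, and it vanishes otherwise
(`weight_of_consistent`, `weight_of_not_consistent`). Hence the superposition has the law of the
arboreal gas (`wiredArborealGas_real_cylinderOn_eq_superposedLaw`).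

Along an exhaustion of the `k`-regular tree, the exit odds converge to the largest fixed point of
`x ↦ β (k - 1) x / (1 + β + (k - 1) x)`, which is `max 0 ((k - 2) β - 1) / (k - 1)`: by monotonicity
they lie between this fixed point and iterates started from the upper bound `β` (`tendsto_exitOdds`).
If the limit is positive, the parameters converge to those of the sampling procedure, and cylinder
probabilities are continuous in the parameters (`tendsto_superposedLaw_real_cylinderOn`). If it is
zero, there are no trails in the limit and the edge probabilities converge to `β / (1 + β)`
(`tendsto_superposedLaw_real_cylinderOn_of_zero`). At the critical value both descriptions agree
(`sampledLaw_critical`).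

The limit is the same for all exhaustions, and an automorphism carries the exhaustion by balls around
`o` to the one by balls around the image of `o`, so the limit is invariant
(`map_relabel_eq_of_tendsto`). Uniqueness of limits also makes the law of the sampling procedure
independent of the choice of `o`.
-/

noncomputable section

/-! ### Rooted trees -/

section RootedTree

variable {V : Type*} {T : SimpleGraph V}

theorem exists_near_far (hT : T.IsTree) (o : V) (e : T.edgeSet) :
    ∃ p : V × V, (e : Sym2 V) = s(p.1, p.2) ∧ T.dist o p.2 = T.dist o p.1 + 1 := by
  obtain ⟨e, he⟩ := e
  induction e with
  | _ x y =>
    rcases hT.dist_eq_dist_add_one_of_adj o (T.mem_edgeSet.1 he) with h | h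
    · exact ⟨(y, x), Sym2.eq_swap, h⟩
    · exact ⟨(x, y), rfl, h⟩

open Classical in
/-- The endpoint `e⁻` of an edge `e` that is nearer to the root `o`. In a tree the condition always
holds, so that the default value plays no role. -/
def near (T : SimpleGraph V) (o : V) (e : T.edgeSet) : V :=
  if h : ∃ p : V × V, (e : Sym2 V) = s(p.1, p.2) ∧ T.dist o p.2 = T.dist o p.1 + 1
  then h.choose.1 else o

open Classical in
/-- The endpoint `e⁺` of an edge `e` that is further from the root `o`. -/
def far (T : SimpleGraph V) (o : V) (e : T.edgeSet) : V :=
  if h : ∃ p : V × V, (e : Sym2 V) = s(p.1, p.2) ∧ T.dist o p.2 = T.dist o p.1 + 1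
  then h.choose.2 else o

theorem edge_eq (hT : T.IsTree) (o : V) (e : T.edgeSet) :
    (e : Sym2 V) = s(near T o e, far T o e) := by
  have h := exists_near_far hT o e
  simp only [near, far, dif_pos h]
  exact h.choose_spec.1

theorem dist_far (hT : T.IsTree) (o : V) (e : T.edgeSet) :
    T.dist o (far T o e) = T.dist o (near T o e) + 1 := by
  have h := exists_near_far hT o e
  simp only [near, far, dif_pos h]
  exact h.choose_spec.2

theorem adj_near_far (hT : T.IsTree) (o : V) (e : T.edgeSet) :
    T.Adj (near T o e) (far T o e) := by
  have := e.2
  rw [edge_eq hT o e] at this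
  exact this

theorem far_ne_root (hT : T.IsTree) (o : V) (e : T.edgeSet) : far T o e ≠ o := by
  intro h
  have := dist_far hT o e
  rw [h, SimpleGraph.dist_self] at this
  omega

theorem near_far_of_eq (hT : T.IsTree) {o u v : V} {e : T.edgeSet} (he : (e : Sym2 V) = s(u, v))
    (hd : T.dist o u < T.dist o v) : near T o e = u ∧ far T o e = v := by
  have h := edge_eq hT o e
  have h' := dist_far hT o e
  rw [he, Sym2.eq_iff] at h
  rcases h with ⟨h1, h2⟩ | ⟨h1, h2⟩
  · exact ⟨h1.symm, h2.symm⟩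
  · rw [← h1, ← h2] at h'; omega

/-- In a tree, a vertex has at most one neighbour closer to the root. -/
theorem parent_unique (hT : T.IsTree) {o u u' v : V} (h : T.Adj u v) (h' : T.Adj u' v)
    (hd : T.dist o v = T.dist o u + 1) (hd' : T.dist o v = T.dist o u' + 1) : u = u' := by
  classical
  obtain ⟨p, hp, hl⟩ := hT.connected.exists_path_of_dist o u
  obtain ⟨p', hp', hl'⟩ := hT.connected.exists_path_of_dist o u'
  have e1 : (p.concat h).IsPath := SimpleGraph.Walk.isPath_of_length_eq_dist _ (by
    rw [SimpleGraph.Walk.length_concat, hl, hd])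
  have e2 : (p'.concat h').IsPath := SimpleGraph.Walk.isPath_of_length_eq_dist _ (by
    rw [SimpleGraph.Walk.length_concat, hl', hd'])
  have := (hT.existsUnique_path o v).unique e1 e2
  have := congrArg SimpleGraph.Walk.penultimate this
  simpa using this

theorem far_injective (hT : T.IsTree) (o : V) : Function.Injective (far T o) := by
  intro e e' h
  have h1 := adj_near_far hT o e
  have h2 := adj_near_far hT o e'
  have h3 := dist_far hT o e
  have h4 := dist_far hT o e'
  rw [← h] at h2 h4
  have := parent_unique hT h1 h2 h3 h4
  apply Subtype.ext
  rw [edge_eq hT o e, edge_eq hT o e', this, h]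

theorem exists_far_eq (hT : T.IsTree) {o v : V} (hv : v ≠ o) : ∃ e, far T o e = v := by
  obtain ⟨p, hp, hl⟩ := hT.connected.exists_path_of_dist o v
  have hnil : ¬ p.Nil := fun h => hv h.eq.symm
  have hadj := p.adj_penultimate hnil
  have h1 : T.dist o p.penultimate < T.dist o v := by
    have := T.dist_le p.dropLast
    have h2 : p.dropLast.length = p.length - 1 := by simp
    have h3 : p.length ≠ 0 := fun h => hnil (SimpleGraph.Walk.length_eq_zero_iff.1 h)
    omega
  exact ⟨⟨s(p.penultimate, v), hadj⟩, (near_far_of_eq hT rfl h1).2⟩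

/-- The set of edges leading from `u` to its children. -/
def edgesBelow (T : SimpleGraph V) (o u : V) : Set T.edgeSet := {e | near T o e = u}

theorem children_eq_image (hT : T.IsTree) (o u : V) :
    children T o u = far T o '' edgesBelow T o u := by
  ext v
  constructor
  · rintro ⟨h, hd⟩
    have := near_far_of_eq hT (o := o) (e := ⟨s(u, v), h⟩) rfl hd
    exact ⟨_, this.1, this.2⟩
  · rintro ⟨e, he, rfl⟩
    have h1 := adj_near_far hT o e
    have h2 := dist_far hT o e
    rw [show near T o e = u from he] at h1 h2
    exact ⟨h1, by omega⟩

theorem neighborSet_root (hT : T.IsTree) (o : V) : T.neighborSet o = children T o o := by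
  ext v
  refine ⟨fun h => ⟨h, ?_⟩, fun h => h.1⟩
  rw [SimpleGraph.dist_self]
  exact hT.connected.pos_dist_of_ne (T.ne_of_adj h)

theorem neighborSet_far (hT : T.IsTree) (o : V) (e : T.edgeSet) :
    T.neighborSet (far T o e) = insert (near T o e) (children T o (far T o e)) := by
  ext v
  constructor
  · intro h
    have h : T.Adj (far T o e) v := h
    rcases hT.dist_eq_dist_add_one_of_adj o h with hd | hd
    · left
      exact parent_unique hT h.symm (adj_near_far hT o e) hd (dist_far hT o e)
    · right
      exact ⟨h, by omega⟩
  · rintro (rfl | h)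
    · exact (adj_near_far hT o e).symm
    · exact h.1

theorem near_notMem_children (hT : T.IsTree) (o : V) (e : T.edgeSet) :
    near T o e ∉ children T o (far T o e) := fun h => by
  have := h.2
  have := dist_far hT o e
  omega

theorem finite_children [T.LocallyFinite] (o u : V) : (children T o u).Finite :=
  (Set.toFinite (T.neighborSet u)).subset fun _ h => h.1

theorem finite_edgesBelow [T.LocallyFinite] (hT : T.IsTree) (o u : V) :
    (edgesBelow T o u).Finite := by
  refine Set.Finite.of_finite_image (f := far T o) ?_ (far_injective hT o).injOn
  rw [← children_eq_image hT]
  exact finite_children o u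

theorem ncard_edgesBelow_root [T.LocallyFinite] (hT : T.IsTree) {k : ℕ}
    (hreg : T.IsRegularOfDegree k) (o : V) : (edgesBelow T o o).ncard = k := by
  rw [← Set.ncard_image_of_injective _ (far_injective hT o), ← children_eq_image hT,
    ← neighborSet_root hT, Set.ncard_eq_toFinset_card', ← hreg o]
  rfl

theorem ncard_edgesBelow_far [T.LocallyFinite] (hT : T.IsTree) {k : ℕ}
    (hreg : T.IsRegularOfDegree k) (o : V) (e : T.edgeSet) :
    (edgesBelow T o (far T o e)).ncard = k - 1 := by
  have h : (T.neighborSet (far T o e)).ncard = k := by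
    rw [Set.ncard_eq_toFinset_card', ← hreg (far T o e)]
    rfl
  rw [neighborSet_far hT, Set.ncard_insert_of_notMem (near_notMem_children hT o e)
    (finite_children _ _)] at h
  rw [← Set.ncard_image_of_injective _ (far_injective hT o), ← children_eq_image hT]
  omega

end RootedTree

/-! ### Trails in the superposed configuration -/

section Trails

variable {V : Type*} {T : SimpleGraph V} {o : V}

/-- The vertex `v` lies on one of the paths `γ(w)`, `w ∈ U`, of the sampling procedure. -/
def OnTrail (T : SimpleGraph V) (o : V) (ω₀ : BondConfig T) (η : V → Bool) (s : V → V) (v : V) :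
    Prop :=
  ∃ w ∈ startVertices T o ω₀ η, ∃ n : ℕ, s^[n] w = v

variable {ω₀ : BondConfig T} {η : V → Bool} {s : V → V}

/-- An edge is open in the superposed configuration if and only if it is open in `ω₀` or the trail
through its nearer endpoint continues through it. Together with `onTrail_root` and `onTrail_far`
this describes the configuration generation by generation. -/
theorem superposition_eq_true_iff (hT : T.IsTree) (hs : ∀ u, s u ∈ children T o u)
    (e : T.edgeSet) : superposition T o ω₀ η s e = true ↔
      ω₀ e = true ∨ (OnTrail T o ω₀ η s (near T o e) ∧ s (near T o e) = far T o e) := by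
  simp only [superposition, decide_eq_true_eq]
  refine or_congr_right ⟨?_, ?_⟩
  · rintro ⟨w, hw, n, hn⟩
    rw [Function.iterate_succ_apply'] at hn
    obtain ⟨h1, h2⟩ := near_far_of_eq hT hn (hs _).2
    rw [h1, h2]
    exact ⟨⟨w, hw, n, rfl⟩, rfl⟩
  · rintro ⟨⟨w, hw, n, hn⟩, h⟩
    refine ⟨w, hw, n, ?_⟩
    rw [Function.iterate_succ_apply', hn, h]
    exact edge_eq hT o e

theorem onTrail_root (hs : ∀ u, s u ∈ children T o u) :
    OnTrail T o ω₀ η s o ↔ η o = true := by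
  constructor
  · rintro ⟨w, hw, n, hn⟩
    cases n with
    | zero =>
      obtain rfl : w = o := hn
      exact hw.1
    | succ n =>
      rw [Function.iterate_succ_apply'] at hn
      have := (hs (s^[n] w)).2
      rw [hn, SimpleGraph.dist_self] at this
      omega
  · intro h
    exact ⟨o, ⟨h, Or.inl rfl⟩, 0, rfl⟩

theorem far_mem_startVertices (hT : T.IsTree) (e : T.edgeSet) :
    far T o e ∈ startVertices T o ω₀ η ↔ ω₀ e = false ∧ η (far T o e) = true := by
  constructor
  · rintro ⟨h1, h2 | ⟨u, h, hd, h3⟩⟩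
    · exact absurd h2 (far_ne_root hT o e)
    · have h4 := (near_far_of_eq hT (e := ⟨s(u, far T o e), h⟩) rfl hd).2
      rw [far_injective hT o h4] at h3
      exact ⟨h3, h1⟩
  · rintro ⟨h1, h2⟩
    refine ⟨h2, Or.inr ⟨near T o e, adj_near_far hT o e, by rw [dist_far hT]; omega, ?_⟩⟩
    rw [← h1]
    congr 1
    exact Subtype.ext (edge_eq hT o e).symm

theorem onTrail_far (hT : T.IsTree) (hs : ∀ u, s u ∈ children T o u) (e : T.edgeSet) :
    OnTrail T o ω₀ η s (far T o e) ↔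
      (OnTrail T o ω₀ η s (near T o e) ∧ s (near T o e) = far T o e) ∨
        (ω₀ e = false ∧ η (far T o e) = true) := by
  constructor
  · rintro ⟨w, hw, n, hn⟩
    cases n with
    | zero =>
      obtain rfl : w = _ := hn
      exact Or.inr ((far_mem_startVertices hT e).1 hw)
    | succ n =>
      left
      rw [Function.iterate_succ_apply'] at hn
      have h := hs (s^[n] w)
      rw [hn] at h
      have h1 : near T o e = s^[n] w := by
        obtain ⟨e', he', h'⟩ := (children_eq_image hT o _).subset h
        rw [← far_injective hT o h']
        exact he'
      rw [h1, hn]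
      exact ⟨⟨w, hw, n, rfl⟩, rfl⟩
  · rintro (⟨⟨w, hw, n, hn⟩, h⟩ | h)
    · exact ⟨w, hw, n + 1, by rw [Function.iterate_succ_apply', hn, h]⟩
    · exact ⟨_, (far_mem_startVertices hT e).2 h, 0, rfl⟩

end Trails

/-! ### Measurability of the superposed configuration -/

section Measurability

variable {V : Type*} {T : SimpleGraph V}

theorem countable_vertices [T.LocallyFinite] [hT : Fact T.IsTree] : Countable V := by
  obtain ⟨o⟩ := hT.out.connected.nonempty
  refine Set.countable_univ_iff.1
    (((Set.countable_singleton o).union (Set.countable_range (far T o))).mono fun v _ => ?_)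
  by_cases hv : v = o
  · exact Or.inl hv
  · exact Or.inr (exists_far_eq hT.out hv)

variable [MeasurableSpace V] [Countable V] (o : V)

theorem measurableSet_mem_startVertices (w : V) :
    MeasurableSet {x : BondConfig T × (V → Bool) × (V → V) |
      w ∈ startVertices T o x.1 x.2.1} := by
  have h0 : Measurable fun x : BondConfig T × (V → Bool) × (V → V) => x.2.1 w := by fun_prop
  have h1 : MeasurableSet {x : BondConfig T × (V → Bool) × (V → V) | x.2.1 w = true} :=
    h0 (measurableSet_singleton true)
  have h2 : ∀ e : T.edgeSet,
      MeasurableSet {x : BondConfig T × (V → Bool) × (V → V) | x.1 e = false} := fun e => by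
    have h : Measurable fun x : BondConfig T × (V → Bool) × (V → V) => x.1 e := by fun_prop
    exact h (measurableSet_singleton false)
  have h3 : MeasurableSet {x : BondConfig T × (V → Bool) × (V → V) |
      ∃ (u : V) (h : T.Adj u w), T.dist o u < T.dist o w ∧ x.1 ⟨s(u, w), h⟩ = false} := by
    have : {x : BondConfig T × (V → Bool) × (V → V) |
        ∃ (u : V) (h : T.Adj u w), T.dist o u < T.dist o w ∧ x.1 ⟨s(u, w), h⟩ = false}
        = ⋃ (u : V) (h : T.Adj u w) (_ : T.dist o u < T.dist o w),
          {x | x.1 ⟨s(u, w), h⟩ = false} := by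
      ext x; simp
    rw [this]
    exact MeasurableSet.iUnion fun u => MeasurableSet.iUnion fun h =>
      MeasurableSet.iUnion fun _ => h2 _
  have h4 : MeasurableSet {_x : BondConfig T × (V → Bool) × (V → V) | w = o} :=
    MeasurableSet.const _
  exact h1.inter (h4.union h3)

variable [DiscreteMeasurableSpace V]

theorem measurable_iterate_apply (n : ℕ) (w : V) : Measurable fun s : V → V => s^[n] w := by
  induction n with
  | zero => exact measurable_const
  | succ n ih =>
    simp only [Function.iterate_succ_apply']
    refine measurable_to_countable' fun x => ?_
    have : (fun s : V → V => s (s^[n] w)) ⁻¹' {x}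
        = ⋃ a, {s : V → V | s^[n] w = a} ∩ {s | s a = x} := by
      ext s
      simp
    rw [this]
    have h : ∀ a, Measurable fun s : V → V => s a := fun a => measurable_pi_apply a
    exact MeasurableSet.iUnion fun a => (ih (measurableSet_singleton a)).inter
      (h a (measurableSet_singleton x))

theorem measurableSet_onTrail (v : V) :
    MeasurableSet {x : BondConfig T × (V → Bool) × (V → V) |
      OnTrail T o x.1 x.2.1 x.2.2 v} := by
  have : {x : BondConfig T × (V → Bool) × (V → V) | OnTrail T o x.1 x.2.1 x.2.2 v}
      = ⋃ w, {x | w ∈ startVertices T o x.1 x.2.1} ∩ ⋃ n : ℕ, {x | x.2.2^[n] w = v} := by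
    ext x; simp [OnTrail]
  rw [this]
  refine MeasurableSet.iUnion fun w => (measurableSet_mem_startVertices o w).inter
    (MeasurableSet.iUnion fun n => ?_)
  exact ((measurable_iterate_apply n w).comp (measurable_snd.comp measurable_snd))
    (measurableSet_singleton v)

theorem measurable_superposition :
    Measurable fun x : BondConfig T × (V → Bool) × (V → V) =>
      superposition T o x.1 x.2.1 x.2.2 := by
  refine measurable_pi_lambda _ fun e => measurable_to_bool ?_
  have : (fun x : BondConfig T × (V → Bool) × (V → V) =>
        superposition T o x.1 x.2.1 x.2.2 e) ⁻¹' {true}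
      = {x | x.1 e = true} ∪ ⋃ v, {x | v ∈ startVertices T o x.1 x.2.1} ∩
        ⋃ n : ℕ, {x | (e : Sym2 V) = s(x.2.2^[n] v, x.2.2^[n + 1] v)} := by
    ext x
    have h : superposition T o x.1 x.2.1 x.2.2 e = true ↔ x.1 e = true ∨
        ∃ v ∈ startVertices T o x.1 x.2.1, e ∈ pathEdges T x.2.2 v := by
      simp only [superposition, decide_eq_true_eq]
    rw [Set.mem_preimage, Set.mem_singleton_iff, h]
    simp [pathEdges]
  rw [this]
  refine MeasurableSet.union ?_ (MeasurableSet.iUnion fun w =>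
    (measurableSet_mem_startVertices o w).inter (MeasurableSet.iUnion fun n => ?_))
  · have h : Measurable fun x : BondConfig T × (V → Bool) × (V → V) => x.1 e := by fun_prop
    exact h (measurableSet_singleton true)
  · have h : Measurable fun x : BondConfig T × (V → Bool) × (V → V) =>
        (x.2.2^[n] w, x.2.2^[n + 1] w) :=
      ((measurable_iterate_apply n w).comp (measurable_snd.comp measurable_snd)).prodMk
        ((measurable_iterate_apply (n + 1) w).comp (measurable_snd.comp measurable_snd))
    exact h (Set.to_countable {p : V × V | (e : Sym2 V) = s(p.1, p.2)}).measurableSet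

end Measurability

/-! ### Local description of the superposed configuration -/

section Cylinders

/-- The finite set of edges leading from `u` to its children. -/
def below {V : Type*} {T : SimpleGraph V} [T.LocallyFinite] (hT : T.IsTree) (o u : V) :
    Finset T.edgeSet :=
  (finite_edgesBelow hT o u).toFinset

variable {V : Type*} {T : SimpleGraph V} [T.LocallyFinite] {hT : T.IsTree} {o : V}

@[simp]
theorem mem_below {u : V} {e : T.edgeSet} : e ∈ below hT o u ↔ near T o e = u := by
  simp [below, edgesBelow]

open Classical in
/-- The edges whose nearer endpoint lies in `S`. -/
def edgesFrom (hT : T.IsTree) (o : V) (S : Finset V) : Finset T.edgeSet :=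
  S.biUnion (below hT o)

@[simp]
theorem mem_edgesFrom {S : Finset V} {e : T.edgeSet} :
    e ∈ edgesFrom hT o S ↔ near T o e ∈ S := by
  simp [edgesFrom]

theorem prod_edgesFrom {M : Type*} [CommMonoid M] (S : Finset V) (f : T.edgeSet → M) :
    ∏ e ∈ edgesFrom hT o S, f e = ∏ u ∈ S, ∏ e ∈ below hT o u, f e := by
  classical
  rw [edgesFrom, Finset.prod_biUnion]
  intro u _ v _ huv
  refine Finset.disjoint_left.2 fun e h h' => huv ?_
  rw [mem_below] at h h'
  exact h.symm.trans h'

/-- A finite set of vertices that contains the root and is closed under taking parents. -/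
structure IsRooted (T : SimpleGraph V) (o : V) (S : Finset V) : Prop where
  root_mem : o ∈ S
  near_mem : ∀ e, far T o e ∈ S → near T o e ∈ S

open Classical in
/-- The set `S` together with the children of its vertices. -/
def withChildren (hT : T.IsTree) (o : V) (S : Finset V) : Finset V :=
  insert o ((edgesFrom hT o S).image (far T o))

theorem far_mem_withChildren {S : Finset V} {e : T.edgeSet} :
    far T o e ∈ withChildren hT o S ↔ near T o e ∈ S := by
  simp only [withChildren, Finset.mem_insert, far_ne_root hT, false_or, Finset.mem_image,
    mem_edgesFrom]
  exact ⟨fun ⟨e', h, h'⟩ => far_injective hT o h' ▸ h, fun h => ⟨e, h, rfl⟩⟩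

theorem root_mem_withChildren {S : Finset V} : o ∈ withChildren hT o S := by
  simp [withChildren]

theorem prod_withChildren {M : Type*} [CommMonoid M] (S : Finset V) (f : V → M) :
    ∏ v ∈ withChildren hT o S, f v = f o * ∏ e ∈ edgesFrom hT o S, f (far T o e) := by
  classical
  rw [withChildren, Finset.prod_insert, Finset.prod_image (far_injective hT o).injOn]
  simp only [Finset.mem_image, not_exists, not_and]
  exact fun e _ h => far_ne_root hT o e h

theorem mem_withChildren_of_mem {S : Finset V} (hS : IsRooted T o S) {v : V} (hv : v ∈ S) :
    v ∈ withChildren hT o S := by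
  by_cases h : v = o
  · exact h ▸ root_mem_withChildren
  · obtain ⟨e, rfl⟩ := exists_far_eq hT h
    exact far_mem_withChildren.2 (hS.near_mem e hv)

variable {ω₀ : BondConfig T} {η : V → Bool} {s : V → V}

/-- The superposed configuration and the set of vertices on trails agree with given sets `G` and
`τ` if and only if conditions on the seeds `ω₀`, `η`, `s` hold at the root and at each edge
separately. -/
theorem agree_iff_local (hs : ∀ u, s u ∈ children T o u) {S : Finset V} (hS : IsRooted T o S)
    (G : Finset T.edgeSet) (τ : Finset V) :
    ((∀ e ∈ edgesFrom hT o S, (superposition T o ω₀ η s e = true ↔ e ∈ G)) ∧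
      ∀ v ∈ withChildren hT o S, (OnTrail T o ω₀ η s v ↔ v ∈ τ)) ↔
    (η o = true ↔ o ∈ τ) ∧ ∀ e ∈ edgesFrom hT o S,
      ((ω₀ e = true ∨ (near T o e ∈ τ ∧ s (near T o e) = far T o e)) ↔ e ∈ G) ∧
      (((near T o e ∈ τ ∧ s (near T o e) = far T o e) ∨
        (ω₀ e = false ∧ η (far T o e) = true)) ↔ far T o e ∈ τ) := by
  constructor
  · rintro ⟨h1, h2⟩
    refine ⟨(onTrail_root hs).symm.trans (h2 o root_mem_withChildren), fun e he => ?_⟩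
    have h3 := h2 (near T o e) (mem_withChildren_of_mem hS (mem_edgesFrom.1 he))
    rw [← h1 e he, ← h2 (far T o e) (far_mem_withChildren.2 (mem_edgesFrom.1 he)), ← h3]
    exact ⟨(superposition_eq_true_iff hT hs e).symm, (onTrail_far hT hs e).symm⟩
  · rintro ⟨h1, h2⟩
    have key : ∀ n, ∀ v ∈ withChildren hT o S, T.dist o v = n →
        (OnTrail T o ω₀ η s v ↔ v ∈ τ) := by
      intro n
      induction n with
      | zero =>
        intro v _ hd
        obtain rfl := hT.connected.dist_eq_zero_iff.1 hd
        exact (onTrail_root hs).trans h1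
      | succ n ih =>
        intro v hv hd
        have hvo : v ≠ o := by
          rintro rfl
          simp at hd
        obtain ⟨e, rfl⟩ := exists_far_eq hT hvo
        have he := far_mem_withChildren.1 hv
        have hn := ih (near T o e) (mem_withChildren_of_mem hS he)
          (by rw [dist_far hT] at hd; omega)
        rw [onTrail_far hT hs, hn]
        exact (h2 e (mem_edgesFrom.2 he)).2
    refine ⟨fun e he => ?_, fun v hv => key _ v hv rfl⟩
    rw [superposition_eq_true_iff hT hs,
      key _ _ (mem_withChildren_of_mem hS (mem_edgesFrom.1 he)) rfl]
    exact (h2 e he).1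

/-- The joint law of `ω₀`, `η` and `s` in the sampling procedure, for arbitrary edge
probabilities `p`, vertex probabilities `r` and laws `ν v` of the chosen children. -/
def seedLaw {V : Type*} (T : SimpleGraph V) [MeasurableSpace V] (p : T.edgeSet → unitInterval)
    (r : V → unitInterval) (ν : V → Measure V) :
    Measure (BondConfig T × (V → Bool) × (V → V)) :=
  (Measure.infinitePi fun e => bernoulliMeasure true false (p e)).prod
    ((Measure.infinitePi fun v => bernoulliMeasure true false (r v)).prod (Measure.infinitePi ν))

open Classical in
/-- The conditional probability that an edge `e` lies in `G` or not and its further endpoint is in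
`τ` or not as prescribed by `G` and `τ`, given whether a trail passes through `e` (`b`). -/
def edgeWeight (T : SimpleGraph V) (o : V) (p : T.edgeSet → unitInterval)
    (r : V → unitInterval) (G : Finset T.edgeSet) (τ : Finset V) (b : Prop) (e : T.edgeSet) : ℝ :=
  if b then (if e ∈ G ∧ far T o e ∈ τ then 1 else 0)
  else if e ∈ G then (if far T o e ∈ τ then 0 else (p e : ℝ))
  else (1 - (p e : ℝ)) * (if far T o e ∈ τ then (r (far T o e) : ℝ) else 1 - (r (far T o e) : ℝ))

open Classical in
/-- The transition weight at a vertex `u`: the probability that the edges below `u` and their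
further endpoints are as prescribed by `G` and `τ`, given whether `u` is in `τ`. The summation
index is the edge leading to the chosen child `s u`. -/
def vertexWeight (hT : T.IsTree) (o : V) [MeasurableSpace V] (p : T.edgeSet → unitInterval)
    (r : V → unitInterval) (ν : V → Measure V) (G : Finset T.edgeSet) (τ : Finset V) (u : V) : ℝ :=
  ∑ e ∈ below hT o u, (ν u).real {far T o e} *
    ∏ e' ∈ below hT o u, edgeWeight T o p r G τ (u ∈ τ ∧ e' = e) e'

open Classical in
/-- The probability that the root is in `τ` or not as prescribed. -/
def rootWeight (o : V) (r : V → unitInterval) (τ : Finset V) : ℝ :=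
  if o ∈ τ then (r o : ℝ) else 1 - (r o : ℝ)

theorem bernoulli_real_true (p : unitInterval) :
    (bernoulliMeasure true false p).real {true} = p := by
  classical
  rw [bernoulliMeasure_real_apply _ (measurableSet_singleton _)]
  simp

theorem bernoulli_real_false (p : unitInterval) :
    (bernoulliMeasure true false p).real {false} = 1 - (p : ℝ) := by
  classical
  rw [bernoulliMeasure_real_apply _ (measurableSet_singleton _)]
  simp

theorem infinitePi_real_pi {ι : Type*} {X : ι → Type*} [∀ i, MeasurableSpace (X i)]
    (μ : ∀ i, Measure (X i)) [∀ i, IsProbabilityMeasure (μ i)] {A : Finset ι}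
    {t : ∀ i, Set (X i)} (ht : ∀ i ∈ A, MeasurableSet (t i)) :
    (Measure.infinitePi μ).real (Set.pi A t) = ∏ i ∈ A, (μ i).real (t i) := by
  rw [measureReal_def, Measure.infinitePi_pi μ ht, ENNReal.toReal_prod]
  rfl

end Cylinders

/-! ### Cylinder probabilities of the superposed configuration -/

section CylinderFormula

variable {V : Type*} {T : SimpleGraph V} {hT : T.IsTree} {o : V}

open Classical in
/-- The states of an edge of `ω₀` compatible with `G` and `τ`, given whether a trail passes. -/
def edgeBox (T : SimpleGraph V) (o : V) (G : Finset T.edgeSet) (τ : Finset V) (b : Prop)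
    (e : T.edgeSet) : Set Bool :=
  if b then (if e ∈ G ∧ far T o e ∈ τ then Set.univ else ∅)
  else if e ∈ G then (if far T o e ∈ τ then ∅ else {true}) else {false}

open Classical in
/-- The states of `η` at the further endpoint of `e` compatible with `G` and `τ`. -/
def farBox (T : SimpleGraph V) (o : V) (G : Finset T.edgeSet) (τ : Finset V) (b : Prop)
    (e : T.edgeSet) : Set Bool :=
  if b ∨ e ∈ G then Set.univ else if far T o e ∈ τ then {true} else {false}

theorem mem_boxes_iff {G : Finset T.edgeSet} {τ : Finset V} {b : Prop} {e : T.edgeSet}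
    {x y : Bool} : (x ∈ edgeBox T o G τ b e ∧ y ∈ farBox T o G τ b e) ↔
      ((x = true ∨ b) ↔ e ∈ G) ∧ ((b ∨ (x = false ∧ y = true)) ↔ far T o e ∈ τ) := by
  unfold edgeBox farBox
  by_cases hb : b <;> by_cases h1 : e ∈ G <;> by_cases h2 : far T o e ∈ τ <;>
    cases x <;> cases y <;> simp [hb, h1, h2]

theorem real_boxes (p : T.edgeSet → unitInterval) (r : V → unitInterval)
    (G : Finset T.edgeSet) (τ : Finset V) (b : Prop) (e : T.edgeSet) :
    (bernoulliMeasure true false (p e)).real (edgeBox T o G τ b e) *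
      (bernoulliMeasure true false (r (far T o e))).real (farBox T o G τ b e) =
    edgeWeight T o p r G τ b e := by
  unfold edgeBox farBox edgeWeight
  by_cases hb : b <;> by_cases h1 : e ∈ G <;> by_cases h2 : far T o e ∈ τ <;>
    simp [hb, h1, h2, bernoulli_real_true, bernoulli_real_false]

variable {G : Finset T.edgeSet} {τ : Finset V}

theorem edgeWeight_false_of_active {p : T.edgeSet → unitInterval} {r : V → unitInterval}
    {e : T.edgeSet} (he : e ∈ G ∧ far T o e ∈ τ) : edgeWeight T o p r G τ False e = 0 := by
  simp [edgeWeight, he.1, he.2]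

theorem edgeWeight_true {p : T.edgeSet → unitInterval} {r : V → unitInterval} {b : Prop}
    (hb : b) {e : T.edgeSet} (he : e ∈ G ∧ far T o e ∈ τ) : edgeWeight T o p r G τ b e = 1 := by
  simp [edgeWeight, he.1, he.2, hb]

theorem edgeWeight_true_of_not {p : T.edgeSet → unitInterval} {r : V → unitInterval} {b : Prop}
    (hb : b) {e : T.edgeSet} (he : ¬ (e ∈ G ∧ far T o e ∈ τ)) :
    edgeWeight T o p r G τ b e = 0 := by
  simp only [edgeWeight, if_pos hb, if_neg he]

instance [MeasurableSpace V] (p : T.edgeSet → unitInterval) (r : V → unitInterval)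
    (ν : V → Measure V) [∀ v, IsProbabilityMeasure (ν v)] :
    IsProbabilityMeasure (seedLaw T p r ν) := by
  unfold seedLaw
  infer_instance

variable [T.LocallyFinite]

/-- The probability, under the seeds of the sampling procedure, that the configuration on the edges
below `S` is `G` and the set of vertices of `S` and its children that lie on trails is `τ`. Up to a null set the event is
a disjoint union, over the choices of the children `s u`, `u ∈ S`, of product events. -/
theorem seedLaw_real_agree [MeasurableSpace V] [DiscreteMeasurableSpace V] [Countable V]
    (p : T.edgeSet → unitInterval) (r : V → unitInterval) (ν : V → Measure V)
    [∀ v, IsProbabilityMeasure (ν v)] (hν : ∀ v, ∀ᵐ w ∂(ν v), w ∈ children T o v)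
    {S : Finset V} (hS : IsRooted T o S) (G : Finset T.edgeSet) (τ : Finset V) :
    (seedLaw T p r ν).real {x |
      (∀ e ∈ edgesFrom hT o S, (superposition T o x.1 x.2.1 x.2.2 e = true ↔ e ∈ G)) ∧
      ∀ v ∈ withChildren hT o S, (OnTrail T o x.1 x.2.1 x.2.2 v ↔ v ∈ τ)} =
    rootWeight o r τ * ∏ u ∈ S, vertexWeight hT o p r ν G τ u := by
  classical
  -- `bσ σ e`: the chosen child of the nearer endpoint of `e` is the further one, if `σ` records
  -- the edges to the chosen children
  let bσ : (∀ u ∈ S, T.edgeSet) → T.edgeSet → Prop := fun σ e =>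
    near T o e ∈ τ ∧ ∃ h, σ (near T o e) h = e
  let Y : (∀ u ∈ S, T.edgeSet) → V → Set Bool := fun σ =>
    Function.extend (far T o) (fun e => farBox T o G τ (bσ σ e) e)
      (fun _ => if o ∈ τ then {true} else {false})
  let Z : (∀ u ∈ S, T.edgeSet) → V → Set V := fun σ u => {w | ∃ h, w = far T o (σ u h)}
  let box : (∀ u ∈ S, T.edgeSet) → Set (BondConfig T × (V → Bool) × (V → V)) := fun σ =>
    Set.pi (edgesFrom hT o S) (fun e => edgeBox T o G τ (bσ σ e) e) ×ˢ
      (Set.pi (withChildren hT o S) (Y σ) ×ˢ Set.pi S (Z σ))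
  have hYfar : ∀ σ e, Y σ (far T o e) = farBox T o G τ (bσ σ e) e := fun σ e =>
    (far_injective hT o).extend_apply _ _ _
  have hYo : ∀ σ, Y σ o = if o ∈ τ then {true} else {false} := fun σ =>
    Function.extend_apply' _ _ _ (fun ⟨e, he⟩ => far_ne_root hT o e he)
  have hgood : ∀ᵐ x ∂(seedLaw T p r ν), ∀ u, x.2.2 u ∈ children T o u := by
    have h1 : ∀ᵐ s ∂(Measure.infinitePi ν), ∀ u, s u ∈ children T o u := by
      rw [ae_all_iff]
      intro u
      have := (measurePreserving_eval_infinitePi ν u).quasiMeasurePreserving.ae (hν u)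
      exact this
    exact (Measure.quasiMeasurePreserving_snd (μ :=
      Measure.infinitePi fun e => bernoulliMeasure true false (p e))).ae
        ((Measure.quasiMeasurePreserving_snd (μ :=
          Measure.infinitePi fun v => bernoulliMeasure true false (r v))).ae h1)
  have hunion : {x : BondConfig T × (V → Bool) × (V → V) |
      (∀ e ∈ edgesFrom hT o S, (superposition T o x.1 x.2.1 x.2.2 e = true ↔ e ∈ G)) ∧
      ∀ v ∈ withChildren hT o S, (OnTrail T o x.1 x.2.1 x.2.2 v ↔ v ∈ τ)} =ᵐ[seedLaw T p r ν]
      ⋃ σ ∈ S.pi (fun u => below hT o u), box σ := by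
    filter_upwards [hgood] with x hs
    refine propext ?_
    change ((∀ e ∈ edgesFrom hT o S, (superposition T o x.1 x.2.1 x.2.2 e = true ↔ e ∈ G)) ∧
      ∀ v ∈ withChildren hT o S, (OnTrail T o x.1 x.2.1 x.2.2 v ↔ v ∈ τ)) ↔
      x ∈ ⋃ σ ∈ S.pi (fun u => below hT o u), box σ
    rw [agree_iff_local hs hS]
    have hbox : ∀ σ : (∀ u ∈ S, T.edgeSet), (∀ u h, x.2.2 u = far T o (σ u h)) → (x ∈ box σ ↔
        (x.2.1 o = true ↔ o ∈ τ) ∧ ∀ e ∈ edgesFrom hT o S,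
          ((x.1 e = true ∨ (near T o e ∈ τ ∧ x.2.2 (near T o e) = far T o e)) ↔ e ∈ G) ∧
          (((near T o e ∈ τ ∧ x.2.2 (near T o e) = far T o e) ∨
            (x.1 e = false ∧ x.2.1 (far T o e) = true)) ↔ far T o e ∈ τ)) := by
      intro σ hσ
      have hb : ∀ e ∈ edgesFrom hT o S,
          ((near T o e ∈ τ ∧ x.2.2 (near T o e) = far T o e) ↔ bσ σ e) := by
        intro e he
        have hm := mem_edgesFrom.1 he
        refine and_congr_right fun _ => ?_
        rw [hσ _ hm, (far_injective hT o).eq_iff]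
        exact ⟨fun h => ⟨hm, h⟩, fun ⟨_, h⟩ => h⟩
      have h1 : x ∈ box σ ↔ (∀ e ∈ edgesFrom hT o S, x.1 e ∈ edgeBox T o G τ (bσ σ e) e) ∧
          (∀ v ∈ withChildren hT o S, x.2.1 v ∈ Y σ v) ∧ ∀ u ∈ S, x.2.2 u ∈ Z σ u := Iff.rfl
      have h2 : ∀ u ∈ S, x.2.2 u ∈ Z σ u := fun u hu => ⟨hu, hσ u hu⟩
      have h3 : (∀ v ∈ withChildren hT o S, x.2.1 v ∈ Y σ v) ↔ (x.2.1 o = true ↔ o ∈ τ) ∧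
          ∀ e ∈ edgesFrom hT o S, x.2.1 (far T o e) ∈ farBox T o G τ (bσ σ e) e := by
        have h4 : x.2.1 o ∈ Y σ o ↔ (x.2.1 o = true ↔ o ∈ τ) := by
          rw [hYo]
          by_cases ho : o ∈ τ <;> simp [ho]
        rw [← h4]
        simp only [withChildren, Finset.mem_insert, Finset.mem_image, forall_eq_or_imp,
          forall_exists_index, and_imp, forall_apply_eq_imp_iff₂, hYfar]
      rw [h1, h3]
      constructor
      · rintro ⟨h5, ⟨h6, h7⟩, -⟩
        refine ⟨h6, fun e he => ?_⟩
        rw [hb e he]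
        exact mem_boxes_iff.1 ⟨h5 e he, h7 e he⟩
      · rintro ⟨h6, h7⟩
        have h8 := fun e he => mem_boxes_iff.2 (by
          have := h7 e he
          rwa [hb e he] at this)
        exact ⟨fun e he => (h8 e he).1, ⟨h6, fun e he => (h8 e he).2⟩, h2⟩
    simp only [Set.mem_iUnion, exists_prop]
    constructor
    · intro h
      have hc : ∀ u, ∃ e, near T o e = u ∧ far T o e = x.2.2 u := by
        intro u
        obtain ⟨e, he, he'⟩ := (children_eq_image hT o u).subset (hs u)
        exact ⟨e, he, he'⟩
      choose c hc1 hc2 using hc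
      exact ⟨fun u _ => c u, by simp [hc1], (hbox _ fun u _ => (hc2 u).symm).2 h⟩
    · rintro ⟨σ, -, hx⟩
      refine (hbox σ fun u hu => ?_).1 hx
      obtain ⟨_, h⟩ := hx.2.2 u hu
      exact h
  have hdisj : Set.PairwiseDisjoint (↑(S.pi (fun u => below hT o u))) box := by
    intro σ _ σ' _ hne
    refine Set.disjoint_left.2 fun x hx hx' => hne ?_
    funext u hu
    obtain ⟨_, h⟩ := hx.2.2 u hu
    obtain ⟨_, h'⟩ := hx'.2.2 u hu
    exact far_injective hT o (h.symm.trans h')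
  have hmeas : ∀ σ, MeasurableSet (box σ) := by
    intro σ
    refine MeasurableSet.prod ?_ (MeasurableSet.prod ?_ ?_)
    · exact MeasurableSet.pi (Finset.countable_toSet _) fun _ _ => MeasurableSet.of_discrete
    · exact MeasurableSet.pi (Finset.countable_toSet _) fun _ _ => MeasurableSet.of_discrete
    · exact MeasurableSet.pi (Finset.countable_toSet _) fun _ _ => MeasurableSet.of_discrete
  have hval : ∀ σ, (seedLaw T p r ν).real (box σ) = rootWeight o r τ *
      ∏ u ∈ S.attach, ((ν u.1).real {far T o (σ u.1 u.2)} *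
        ∏ e' ∈ below hT o u.1, edgeWeight T o p r G τ (u.1 ∈ τ ∧ e' = σ u.1 u.2) e') := by
    intro σ
    rw [seedLaw, measureReal_prod_prod, measureReal_prod_prod,
      infinitePi_real_pi _ (fun _ _ => MeasurableSet.of_discrete),
      infinitePi_real_pi _ (fun _ _ => MeasurableSet.of_discrete),
      infinitePi_real_pi _ (fun _ _ => MeasurableSet.of_discrete), prod_withChildren,
      Finset.prod_mul_distrib]
    have e1 : (bernoulliMeasure true false (r o)).real (Y σ o) = rootWeight o r τ := by
      rw [hYo, rootWeight]
      split_ifs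
      · exact bernoulli_real_true _
      · exact bernoulli_real_false _
    have e2 : ∏ u ∈ S, (ν u).real (Z σ u)
        = ∏ u ∈ S.attach, (ν u.1).real {far T o (σ u.1 u.2)} := by
      rw [← Finset.prod_attach]
      refine Finset.prod_congr rfl fun u _ => ?_
      congr 1
      ext w
      exact ⟨fun ⟨_, h⟩ => h, fun h => ⟨u.2, h⟩⟩
    have e3 : (∏ e ∈ edgesFrom hT o S,
          (bernoulliMeasure true false (p e)).real (edgeBox T o G τ (bσ σ e) e)) *
        ∏ e ∈ edgesFrom hT o S, (bernoulliMeasure true false (r (far T o e))).real (Y σ (far T o e))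
        = ∏ u ∈ S.attach, ∏ e' ∈ below hT o u.1,
          edgeWeight T o p r G τ (u.1 ∈ τ ∧ e' = σ u.1 u.2) e' := by
      rw [← Finset.prod_mul_distrib, prod_edgesFrom, ← Finset.prod_attach]
      refine Finset.prod_congr rfl fun u _ => Finset.prod_congr rfl fun e he => ?_
      rw [hYfar, real_boxes]
      congr 1
      obtain ⟨u, hu⟩ := u
      obtain rfl := mem_below.1 he
      refine propext (and_congr_right fun _ => ?_)
      exact ⟨fun ⟨_, h⟩ => h.symm, fun h => ⟨hu, h.symm⟩⟩
    rw [e1, e2, ← e3]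
    ring
  rw [measureReal_congr hunion, measureReal_biUnion_finset hdisj (fun σ _ => hmeas σ)
    (fun σ _ => measure_ne_top _ _)]
  simp only [hval]
  rw [← Finset.mul_sum]
  congr 1
  unfold vertexWeight
  rw [Finset.prod_sum]

/-- The configurations that are open exactly on `G` among the edges in `A`. -/
def cylinderOn {ε : Type*} (A G : Finset ε) : Set (ε → Bool) := {ω | ∀ e ∈ A, (ω e = true ↔ e ∈ G)}

theorem measurableSet_cylinderOn {ε : Type*} (A G : Finset ε) :
    MeasurableSet (cylinderOn A G) := by
  classical
  have : cylinderOn A G = Set.pi A fun e => {b | b = true ↔ e ∈ G} := rfl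
  rw [this]
  exact MeasurableSet.pi (Finset.countable_toSet _) fun _ _ => MeasurableSet.of_discrete

/-- The law of the superposed configuration for arbitrary parameters `p`, `r` and `ν`. -/
def superposedLaw {V : Type*} (T : SimpleGraph V) (o : V) [MeasurableSpace V]
    (p : T.edgeSet → unitInterval) (r : V → unitInterval) (ν : V → Measure V) :
    Measure (BondConfig T) :=
  Measure.map (fun x : BondConfig T × (V → Bool) × (V → V) => superposition T o x.1 x.2.1 x.2.2)
    (seedLaw T p r ν)

/-- Cylinder probabilities of the superposed configuration, as a sum over the possible sets of
vertices that lie on trails. -/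
theorem superposedLaw_real_cylinderOn [MeasurableSpace V] [DiscreteMeasurableSpace V] [Countable V]
    (p : T.edgeSet → unitInterval) (r : V → unitInterval) (ν : V → Measure V)
    [∀ v, IsProbabilityMeasure (ν v)] (hν : ∀ v, ∀ᵐ w ∂(ν v), w ∈ children T o v)
    {S : Finset V} (hS : IsRooted T o S) (G : Finset T.edgeSet) :
    (superposedLaw T o p r ν).real (cylinderOn (edgesFrom hT o S) G) =
      ∑ τ ∈ (withChildren hT o S).powerset,
        rootWeight o r τ * ∏ u ∈ S, vertexWeight hT o p r ν G τ u := by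
  classical
  have hmc := measurableSet_cylinderOn (edgesFrom hT o S) G
  rw [superposedLaw, map_measureReal_apply (measurable_superposition o) hmc]
  have hm : ∀ τ : Finset V, MeasurableSet {x : BondConfig T × (V → Bool) × (V → V) |
      (∀ e ∈ edgesFrom hT o S, (superposition T o x.1 x.2.1 x.2.2 e = true ↔ e ∈ G)) ∧
      ∀ v ∈ withChildren hT o S, (OnTrail T o x.1 x.2.1 x.2.2 v ↔ v ∈ τ)} := by
    intro τ
    have h : {x : BondConfig T × (V → Bool) × (V → V) |
        ∀ v ∈ withChildren hT o S, (OnTrail T o x.1 x.2.1 x.2.2 v ↔ v ∈ τ)} =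
        ⋂ v ∈ withChildren hT o S, {x | OnTrail T o x.1 x.2.1 x.2.2 v ↔ v ∈ τ} := by
      ext x; simp
    have h' := Finset.measurableSet_biInter (withChildren hT o S) fun v _ =>
      (measurableSet_onTrail (T := T) o v).iff (MeasurableSet.const (v ∈ τ))
    rw [← h] at h'
    exact (measurable_superposition o hmc).inter h'
  have hdisj : Set.PairwiseDisjoint (↑(withChildren hT o S).powerset)
      fun τ : Finset V => {x : BondConfig T × (V → Bool) × (V → V) |
        (∀ e ∈ edgesFrom hT o S, (superposition T o x.1 x.2.1 x.2.2 e = true ↔ e ∈ G)) ∧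
        ∀ v ∈ withChildren hT o S, (OnTrail T o x.1 x.2.1 x.2.2 v ↔ v ∈ τ)} := by
    intro τ hτ τ' hτ' hne
    refine Set.disjoint_left.2 fun x hx hx' => hne ?_
    ext v
    by_cases hv : v ∈ withChildren hT o S
    · exact (hx.2 v hv).symm.trans (hx'.2 v hv)
    · exact ⟨fun h => absurd (Finset.mem_powerset.1 hτ h) hv,
        fun h => absurd (Finset.mem_powerset.1 hτ' h) hv⟩
  rw [← Finset.sum_congr rfl fun τ _ => seedLaw_real_agree (hT := hT) p r ν hν hS G τ,
    ← measureReal_biUnion_finset hdisj (fun τ _ => hm τ) (fun τ _ => measure_ne_top _ _)]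
  congr 1
  ext x
  simp only [Set.mem_iUnion, exists_prop]
  constructor
  · intro h
    refine ⟨(withChildren hT o S).filter fun v => OnTrail T o x.1 x.2.1 x.2.2 v,
      Finset.mem_powerset.2 (Finset.filter_subset _ _), h, fun v hv => ?_⟩
    simp [hv]
  · rintro ⟨τ, -, h⟩
    exact h.1

end CylinderFormula

/-! ### Forests of the wired graph -/

section WiredForests

variable {V : Type*} {T : SimpleGraph V} {o : V}

open Classical in
/-- The projection of the vertices of `T` to the vertices of the wired graph. -/
def wireVertex (S : Finset V) (v : V) : Option V := if v ∈ S then some v else none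

theorem wireVertex_of_mem {S : Finset V} {v : V} (h : v ∈ S) : wireVertex S v = some v := by
  simp [wireVertex, h]

theorem wireVertex_of_notMem {S : Finset V} {v : V} (h : v ∉ S) : wireVertex S v = none := by
  simp [wireVertex, h]

theorem near_mem_of_isLink (hT : T.IsTree) {S : Finset V} (hS : IsRooted T o S) {e : T.edgeSet}
    {a b : Option V} (h : (wiredGraph T S).IsLink e a b) : near T o e ∈ S := by
  obtain ⟨x, y, ⟨he, hx, hy⟩, -, -⟩ := h
  by_contra hn
  have hf : far T o e ∉ S := fun h => hn (hS.near_mem e h)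
  -- an outer vertex adjacent to `S` is the further endpoint of the edge that joins it to `S`
  have hout : far T o e ∈ withNeighbours T S → False := by
    rintro (h | ⟨u, hu, hadj⟩)
    · exact hf h
    · rcases hT.dist_eq_dist_add_one_of_adj o hadj with hd | hd
      · have h := near_far_of_eq hT (o := o) (e := ⟨s(far T o e, u), hadj.symm⟩) rfl
          (by omega)
        have := hS.near_mem ⟨s(far T o e, u), hadj.symm⟩ (by rw [h.2]; exact hu)
        rw [h.1] at this
        exact hf this
      · have := parent_unique hT hadj (adj_near_far hT o e) hd (dist_far hT o e)
        exact hn (this ▸ hu)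
  rw [edge_eq hT o e, Sym2.eq_iff] at he
  rcases he with ⟨-, h⟩ | ⟨-, h⟩
  · exact hout (h ▸ hy)
  · exact hout (h ▸ hx)

theorem mem_withNeighbours_of_near_mem (hT : T.IsTree) {S : Finset V} {e : T.edgeSet}
    (h : near T o e ∈ S) {x y : V} (he : (e : Sym2 V) = s(x, y)) :
    x ∈ withNeighbours T S ∧ y ∈ withNeighbours T S := by
  have h1 : near T o e ∈ withNeighbours T S := Or.inl h
  have h2 : far T o e ∈ withNeighbours T S := Or.inr ⟨_, h, adj_near_far hT o e⟩
  rw [edge_eq hT o e, Sym2.eq_iff] at he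
  rcases he with ⟨hx, hy⟩ | ⟨hx, hy⟩
  · exact ⟨hx ▸ h1, hy ▸ h2⟩
  · exact ⟨hy ▸ h2, hx ▸ h1⟩

theorem isLink_wiredGraph_of_eq (hT : T.IsTree) {S : Finset V} {e : T.edgeSet}
    (h : near T o e ∈ S) {x y : V} (he : (e : Sym2 V) = s(x, y)) :
    (wiredGraph T S).IsLink e (wireVertex S x) (wireVertex S y) :=
  ⟨x, y, ⟨he, mem_withNeighbours_of_near_mem hT h he⟩, rfl, rfl⟩

theorem isLink_wiredGraph_cases (hT : T.IsTree) {S : Finset V} (hS : IsRooted T o S)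
    {e : T.edgeSet} {a b : Option V} (h : (wiredGraph T S).IsLink e a b) :
    (a = some (near T o e) ∧ b = wireVertex S (far T o e)) ∨
      (a = wireVertex S (far T o e) ∧ b = some (near T o e)) := by
  have hn := near_mem_of_isLink hT hS h
  obtain ⟨x, y, ⟨he, -, -⟩, rfl, rfl⟩ := h
  rw [edge_eq hT o e, Sym2.eq_iff] at he
  rw [← wireVertex_of_mem hn]
  rcases he with ⟨hx, hy⟩ | ⟨hx, hy⟩
  · exact Or.inl ⟨by rw [hx]; rfl, by rw [hy]; rfl⟩
  · exact Or.inr ⟨by rw [hy]; rfl, by rw [hx]; rfl⟩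

theorem mem_edgeSet_wiredGraph_iff (hT : T.IsTree) {S : Finset V} (hS : IsRooted T o S)
    {e : T.edgeSet} : e ∈ (wiredGraph T S).edgeSet ↔ near T o e ∈ S := by
  rw [Graph.edge_mem_iff_exists_isLink]
  exact ⟨fun ⟨a, b, h⟩ => near_mem_of_isLink hT hS h,
    fun h => ⟨_, _, isLink_wiredGraph_of_eq hT h (edge_eq hT o e)⟩⟩

/-- A path of edges of `F` leads from `v` away from the root to a vertex outside `S`. -/
inductive ReachesOut (T : SimpleGraph V) (o : V) (S : Finset V) (F : Finset T.edgeSet) : V → Prop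
  | out (v : V) : v ∉ S → ReachesOut T o S F v
  | step (e : T.edgeSet) : e ∈ F → ReachesOut T o S F (far T o e) →
      ReachesOut T o S F (near T o e)

theorem reachesOut_iff {S : Finset V} {F : Finset T.edgeSet} {v : V} (hv : v ∈ S) :
    ReachesOut T o S F v ↔ ∃ e ∈ F, near T o e = v ∧ ReachesOut T o S F (far T o e) := by
  constructor
  · intro h
    cases h with
    | out _ h => exact absurd hv h
    | step e he h => exact ⟨e, he, rfl, h⟩
  · rintro ⟨e, he, rfl, h⟩
    exact .step e he h

/-- Every vertex of `S` has at most one child, joined to it by an edge of `F`, from which `F` leads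
outside `S`. -/
def UniqueExits (T : SimpleGraph V) (o : V) (S : Finset V) (F : Finset T.edgeSet) : Prop :=
  ∀ e ∈ F, ∀ e' ∈ F, near T o e = near T o e' → ReachesOut T o S F (far T o e) →
    ReachesOut T o S F (far T o e') → e = e'

open Classical in
/-- A potential that increases along the edges of a forest when they are oriented towards the
boundary if they lead there, and towards the root otherwise. -/
def exitPotential (T : SimpleGraph V) (o : V) (S : Finset V) (F : Finset T.edgeSet) :
    Option V → WithTop ℤ
  | none => ⊤
  | some v => if ReachesOut T o S F v then ((T.dist o v + 1 : ℤ) : WithTop ℤ)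
      else ((-T.dist o v - 1 : ℤ) : WithTop ℤ)

/-- An edge that does not decrease the potential leads from `x` towards an exit, or it leads from a
vertex without exit towards the root. -/
theorem exit_or_parent_of_potential_le (hT : T.IsTree) {S : Finset V} (hS : IsRooted T o S)
    {F : Finset T.edgeSet} {e : T.edgeSet} (he : e ∈ F) {x y : Option V}
    (h : (wiredGraph T S).IsLink e x y)
    (hle : exitPotential T o S F x ≤ exitPotential T o S F y) :
    (x = some (near T o e) ∧ ReachesOut T o S F (far T o e)) ∨
      (x = some (far T o e) ∧ ¬ ReachesOut T o S F (far T o e)) := by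
  have hd := dist_far hT o e
  rcases isLink_wiredGraph_cases hT hS h with ⟨rfl, rfl⟩ | ⟨rfl, rfl⟩
  · refine Or.inl ⟨rfl, ?_⟩
    by_contra hr
    have hf : far T o e ∈ S := by
      by_contra hf
      exact hr (.out _ hf)
    rw [wireVertex_of_mem hf] at hle
    simp only [exitPotential, if_neg hr] at hle
    split_ifs at hle <;> rw [WithTop.coe_le_coe] at hle <;> omega
  · refine Or.inr ?_
    by_cases hf : far T o e ∈ S
    · rw [wireVertex_of_mem hf] at hle ⊢
      refine ⟨rfl, fun hr => ?_⟩
      simp only [exitPotential, if_pos hr, if_pos (ReachesOut.step e he hr)] at hle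
      rw [WithTop.coe_le_coe] at hle
      omega
    · rw [wireVertex_of_notMem hf] at hle
      simp only [exitPotential, top_le_iff] at hle
      split_ifs at hle <;> exact absurd hle (WithTop.coe_ne_top)

theorem not_isLink_self (hT : T.IsTree) {S : Finset V} (hS : IsRooted T o S) {e : T.edgeSet}
    {x : Option V} : ¬ (wiredGraph T S).IsLink e x x := by
  intro h
  have hne := (adj_near_far hT o e).ne
  have h' : some (near T o e) = wireVertex S (far T o e) := by
    rcases isLink_wiredGraph_cases hT hS h with ⟨h1, h2⟩ | ⟨h1, h2⟩
    · exact h1.symm.trans h2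
    · exact h2.symm.trans h1
  unfold wireVertex at h'
  split_ifs at h'
  exact hne (Option.some_injective _ h')

/-- A set of edges with unique exits contains no cycle: at a vertex of a cycle where the potential
is minimal, both edges of the cycle would have to be the unique edge that increases it. -/
theorem not_containsCycle_of_uniqueExits (hT : T.IsTree) {S : Finset V} (hS : IsRooted T o S)
    {F : Finset T.edgeSet} (hF : UniqueExits T o S F) :
    ¬ (wiredGraph T S).ContainsCycle (F : Set T.edgeSet) := by
  rintro ⟨m, v, e, -, he, h⟩
  obtain ⟨i, hi⟩ := Finite.exists_min fun i => exitPotential T o S F (v i)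
  have h1 := exit_or_parent_of_potential_le hT hS (Finset.mem_coe.1 (h i).1) (h i).2 (hi _)
  have hl : (wiredGraph T S).IsLink (e (i - 1)) (v i) (v (i - 1)) := by
    have := (h (i - 1)).2
    rw [sub_add_cancel] at this
    exact this.symm
  have h2 := exit_or_parent_of_potential_le hT hS (Finset.mem_coe.1 (h (i - 1)).1) hl (hi _)
  have heq : e i = e (i - 1) := by
    rcases h1 with ⟨a1, b1⟩ | ⟨a1, b1⟩ <;> rcases h2 with ⟨a2, b2⟩ | ⟨a2, b2⟩
    · exact hF _ (h i).1 _ (h (i - 1)).1 (Option.some_injective _ (a1.symm.trans a2)) b1 b2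
    · have := Option.some_injective _ (a1.symm.trans a2)
      exact absurd (this ▸ ReachesOut.step _ (h i).1 b1) b2
    · have := Option.some_injective _ (a2.symm.trans a1)
      exact absurd (this ▸ ReachesOut.step _ (h (i - 1)).1 b2) b1
    · exact far_injective hT o (Option.some_injective _ (a1.symm.trans a2))
  have h3 : i = i - 1 := he heq
  rw [← h3] at hl
  exact not_isLink_self hT hS hl

theorem mk_getVert_mem_edges {a b : V} (p : T.Walk a b) {i : ℕ} (hi : i < p.length) :
    s(p.getVert i, p.getVert (i + 1)) ∈ p.edges := by
  induction p generalizing i with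
  | nil => simp at hi
  | cons h q ih =>
    rw [SimpleGraph.Walk.edges_cons, List.mem_cons]
    cases i with
    | zero => left; simp
    | succ i =>
      right
      simpa using ih (by simpa using hi)

/-- A path of `T` between two distinct vertices outside `S` whose inner vertices lie in `S` becomes
a cycle of the wired graph. -/
theorem containsCycle_of_isPath (hT : T.IsTree) {S : Finset V} {F : Finset T.edgeSet}
    (hFS : ∀ e ∈ F, near T o e ∈ S) {a b : V} (hab : a ≠ b) (ha : a ∉ S) (hb : b ∉ S)
    (p : T.Walk a b) (hp : p.IsPath) (hpF : ∀ e : T.edgeSet, (e : Sym2 V) ∈ p.edges → e ∈ F)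
    (hpS : ∀ v ∈ p.support, v ∈ S ∨ v = a ∨ v = b) :
    (wiredGraph T S).ContainsCycle (F : Set T.edgeSet) := by
  obtain ⟨m, hm⟩ : ∃ m, p.length = m + 1 := by
    refine Nat.exists_eq_succ_of_ne_zero fun h => hab ?_
    exact SimpleGraph.Walk.eq_of_length_eq_zero h
  have hinj := hp.getVert_injOn
  have hadj : ∀ i : Fin (m + 1), s(p.getVert i, p.getVert (i + 1)) ∈ T.edgeSet := fun i =>
    p.adj_getVert_succ (by omega)
  have hv0 : wireVertex S (p.getVert 0) = none := by
    rw [SimpleGraph.Walk.getVert_zero]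
    exact wireVertex_of_notMem ha
  have hvm : wireVertex S (p.getVert (m + 1)) = none := by
    rw [← hm, SimpleGraph.Walk.getVert_length]
    exact wireVertex_of_notMem hb
  have hvi : ∀ i, i ≠ 0 → i < m + 1 → wireVertex S (p.getVert i) = some (p.getVert i) := by
    intro i h0 hi
    refine wireVertex_of_mem ?_
    rcases hpS _ (p.getVert_mem_support i) with h | h | h
    · exact h
    · refine absurd (hinj ?_ ?_ (h.trans p.getVert_zero.symm)) h0
      · exact Set.mem_ofPred_eq ▸ (by omega)
      · exact Set.mem_ofPred_eq ▸ (by omega)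
    · refine absurd (hinj ?_ ?_ (h.trans p.getVert_length.symm)) (by omega)
      · exact Set.mem_ofPred_eq ▸ (by omega)
      · exact Set.mem_ofPred_eq ▸ (by omega)
  refine ⟨m, fun i => wireVertex S (p.getVert i),
    fun i => ⟨s(p.getVert i, p.getVert (i + 1)), hadj i⟩, ?_, ?_, fun i => ⟨?_, ?_⟩⟩
  · intro i j hij
    simp only at hij
    by_cases hi : (i : ℕ) = 0 <;> by_cases hj : (j : ℕ) = 0
    · exact Fin.ext (hi.trans hj.symm)
    · rw [hi, hv0, hvi j hj j.2] at hij
      cases hij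
    · rw [hj, hv0, hvi i hi i.2] at hij
      cases hij
    · rw [hvi i hi i.2, hvi j hj j.2] at hij
      refine Fin.ext (hinj ?_ ?_ (Option.some_injective _ hij))
      · exact Set.mem_ofPred_eq ▸ (by omega)
      · exact Set.mem_ofPred_eq ▸ (by omega)
  · intro i j hij
    have hmem : ∀ n, n ≤ m + 1 → n ∈ {n | n ≤ p.length} := fun n hn => by
      rw [hm]; exact hn
    rcases Sym2.eq_iff.1 (Subtype.ext_iff.1 hij) with ⟨h1, -⟩ | ⟨h1, h2⟩
    · exact Fin.ext (hinj (hmem _ (by omega)) (hmem _ (by omega)) h1)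
    · have h3 := hinj (hmem _ (by omega)) (hmem _ (by omega)) h1
      have h4 := hinj (hmem _ (by omega)) (hmem _ (by omega)) h2
      omega
  · refine hpF _ ?_
    exact mk_getVert_mem_edges p (by omega)
  · have hF := hFS _ (hpF ⟨s(p.getVert i, p.getVert (i + 1)), hadj i⟩
      (mk_getVert_mem_edges p (by omega)))
    have hl := isLink_wiredGraph_of_eq hT hF rfl
    by_cases hi : i = Fin.last m
    · subst hi
      simp only [Fin.last_add_one, Fin.val_zero, Fin.val_last] at hl ⊢
      rw [hvm] at hl
      rw [hv0]
      exact hl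
    · have hval : ((i + 1 : Fin (m + 1)) : ℕ) = i + 1 :=
        Fin.val_add_one_of_lt (Fin.lt_last_iff_ne_last.2 hi)
      change (wiredGraph T S).IsLink _ _ (wireVertex S (p.getVert ((i + 1 : Fin (m + 1)) : ℕ)))
      rw [hval]
      exact hl

theorem exists_walk_of_reachesOut (hT : T.IsTree) {S : Finset V} {F : Finset T.edgeSet}
    (hFS : ∀ e ∈ F, near T o e ∈ S) {v : V} (h : ReachesOut T o S F v) :
    ∃ b, b ∉ S ∧ ∃ p : T.Walk v b, (∀ e : T.edgeSet, (e : Sym2 V) ∈ p.edges → e ∈ F) ∧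
      (∀ w ∈ p.support, w ∈ S ∨ w = b) ∧ T.dist o b = T.dist o v + p.length := by
  induction h with
  | out v hv => exact ⟨v, hv, .nil, by simp, by simp, by simp⟩
  | step e he _ ih =>
    obtain ⟨b, hb, p, h1, h2, h3⟩ := ih
    refine ⟨b, hb, .cons (adj_near_far hT o e) p, ?_, ?_, ?_⟩
    · intro e' he'
      rw [SimpleGraph.Walk.edges_cons, List.mem_cons] at he'
      rcases he' with h | h
      · rw [← edge_eq hT o e] at h
        exact Subtype.ext h ▸ he
      · exact h1 e' h
    · intro w hw
      rw [SimpleGraph.Walk.support_cons, List.mem_cons] at hw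
      rcases hw with rfl | hw
      · exact Or.inl (hFS e he)
      · exact h2 w hw
    · rw [h3, dist_far hT, SimpleGraph.Walk.length_cons]
      omega

/-- Walks away from the root with a common end and starting points at the same distance from the
root have the same starting point. -/
theorem start_eq_of_descending (hT : T.IsTree) {v v' b : V} (p : T.Walk v b) (p' : T.Walk v' b)
    (hp : T.dist o b = T.dist o v + p.length) (hp' : T.dist o b = T.dist o v' + p'.length)
    (hv : T.dist o v = T.dist o v') : v = v' := by
  obtain ⟨q, -, hq⟩ := hT.connected.exists_path_of_dist o v
  obtain ⟨q', -, hq'⟩ := hT.connected.exists_path_of_dist o v'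
  have e1 : (q.append p).IsPath := SimpleGraph.Walk.isPath_of_length_eq_dist _ (by
    rw [SimpleGraph.Walk.length_append, hq, hp])
  have e2 : (q'.append p').IsPath := SimpleGraph.Walk.isPath_of_length_eq_dist _ (by
    rw [SimpleGraph.Walk.length_append, hq', hp'])
  have h := congrArg (fun w => SimpleGraph.Walk.getVert w (T.dist o v))
    ((hT.existsUnique_path o b).unique e1 e2)
  simpa [SimpleGraph.Walk.getVert_append, hq, hq', hv] using h

theorem uniqueExits_of_not_containsCycle (hT : T.IsTree) {S : Finset V}
    {F : Finset T.edgeSet} (hFS : ∀ e ∈ F, near T o e ∈ S)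
    (h : ¬ (wiredGraph T S).ContainsCycle (F : Set T.edgeSet)) : UniqueExits T o S F := by
  classical
  intro e he e' he' hn hr hr'
  by_contra hne
  obtain ⟨b, hb, p, h1, h2, h3⟩ := exists_walk_of_reachesOut hT hFS hr
  obtain ⟨b', hb', p', h1', h2', h3'⟩ := exists_walk_of_reachesOut hT hFS hr'
  have hbb : b ≠ b' := by
    rintro rfl
    refine hne (far_injective hT o (start_eq_of_descending hT p p' h3 h3' ?_))
    rw [dist_far hT, dist_far hT, hn]
  have hadj : T.Adj (far T o e) (near T o e) := (adj_near_far hT o e).symm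
  have hadj' : T.Adj (near T o e) (far T o e') := hn ▸ adj_near_far hT o e'
  refine h (containsCycle_of_isPath hT hFS hbb hb hb'
    (p.reverse.append (.cons hadj (.cons hadj' p'))).bypass
    (SimpleGraph.Walk.bypass_isPath _) ?_ ?_)
  · intro f hf
    have hf := SimpleGraph.Walk.edges_bypass_subset_edges _ hf
    simp only [SimpleGraph.Walk.edges_append, SimpleGraph.Walk.edges_reverse,
      SimpleGraph.Walk.edges_cons, List.mem_append, List.mem_reverse, List.mem_cons] at hf
    rcases hf with hf | hf | hf | hf
    · exact h1 f hf
    · rw [Sym2.eq_swap, ← edge_eq hT o e] at hf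
      exact Subtype.ext hf ▸ he
    · rw [hn, ← edge_eq hT o e'] at hf
      exact Subtype.ext hf ▸ he'
    · exact h1' f hf
  · intro w hw
    have hw := SimpleGraph.Walk.support_bypass_subset_support _ hw
    simp only [SimpleGraph.Walk.mem_support_append_iff, SimpleGraph.Walk.support_reverse,
      SimpleGraph.Walk.support_cons, List.mem_reverse, List.mem_cons] at hw
    rcases hw with hw | rfl | rfl | hw
    · exact (h2 w hw).imp_right Or.inl
    · exact (h2 _ p.start_mem_support).imp_right Or.inl
    · exact Or.inl (hFS e he)
    · exact (h2' w hw).imp_right Or.inr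

theorem isForest_wiredGraph_iff (hT : T.IsTree) {S : Finset V} (hS : IsRooted T o S)
    {F : Finset T.edgeSet} : (wiredGraph T S).IsForest (F : Set T.edgeSet) ↔
      (∀ e ∈ F, near T o e ∈ S) ∧ UniqueExits T o S F := by
  have h : (F : Set T.edgeSet) ⊆ (wiredGraph T S).edgeSet ↔ ∀ e ∈ F, near T o e ∈ S :=
    ⟨fun h e he => (mem_edgeSet_wiredGraph_iff hT hS).1 (h he),
      fun h e he => (mem_edgeSet_wiredGraph_iff hT hS).2 (h e he)⟩
  rw [Graph.IsForest, h]
  exact and_congr_right fun hF => ⟨uniqueExits_of_not_containsCycle hT hF,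
    not_containsCycle_of_uniqueExits hT hS⟩

end WiredForests

/-! ### Parameters that produce the arboreal gas -/

section GasParameters

variable {V : Type*} {T : SimpleGraph V} [T.LocallyFinite] {hT : T.IsTree} {o : V}

/-- A real number, clamped to the unit interval. -/
def clampUnit (x : ℝ) : unitInterval := Set.projIcc 0 1 zero_le_one x

theorem coe_clampUnit {x : ℝ} (h0 : 0 ≤ x) (h1 : x ≤ 1) : (clampUnit x : ℝ) = x := by
  rw [clampUnit, Set.projIcc_of_mem zero_le_one ⟨h0, h1⟩]

/-- The sum of `φ` over the children of `v`. -/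
def childSum (hT : T.IsTree) (o : V) (φ : V → ℝ) (v : V) : ℝ := ∑ e ∈ below hT o v, φ (far T o e)

/-- The function `φ` gives the exit odds of the vertices: the total weight of the states of the edge
above `v` and of the forest below `v` for which the parent of `v` is connected to the boundary
through `v`, divided by the total weight of those for which it is not. A vertex of a forest reaches
the boundary through at most one child, so the sum `q` of `φ` over the children of `v ∈ S` is the
ratio of the weights of the forests below `v` in which `v` is, respectively is not, connected to the
boundary. An open edge has weight `β` and a closed one has weight `1`, which gives
`φ v = β q / (1 + β + q)`. Outside `S` the vertex is the boundary itself, and `φ v = β`. -/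
structure IsExitOdds (hT : T.IsTree) (o : V) (S : Finset V) (β : ℝ) (φ : V → ℝ) : Prop where
  pos : ∀ v, 0 < φ v
  of_mem : ∀ v ∈ S, φ v = β * childSum hT o φ v / (1 + β + childSum hT o φ v)
  of_notMem : ∀ v ∉ S, φ v = β

open Classical in
/-- The probability, under the arboreal gas, that an edge is open, given that its nearer endpoint is
not connected to the boundary through it. An edge to a boundary vertex is then closed. -/
def gasEdgeProb (hT : T.IsTree) (o : V) (S : Finset V) (β : ℝ) (φ : V → ℝ) (e : T.edgeSet) :
    unitInterval :=
  if far T o e ∈ S then clampUnit (β / (1 + β + childSum hT o φ (far T o e))) else 0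

open Classical in
/-- The probability that a vertex is connected to the boundary below it, given that the edge above
it is closed. -/
def gasVertexProb (hT : T.IsTree) (o : V) (S : Finset V) (φ : V → ℝ) (v : V) : unitInterval :=
  if v ∈ S then clampUnit (childSum hT o φ v / (1 + childSum hT o φ v)) else 1

open Classical in
/-- The law of the child through which `v` is connected to the boundary. The choice outside `S` is
immaterial. -/
def gasChildLaw [MeasurableSpace V] (hT : T.IsTree) (o : V) (S : Finset V) (φ : V → ℝ) (v : V) :
    Measure V :=
  if v ∈ S then ∑ e ∈ below hT o v,
    ENNReal.ofReal (φ (far T o e) / childSum hT o φ v) • Measure.dirac (far T o e)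
  else uniformOn (children T o v)

variable {S : Finset V} {β : ℝ} {φ : V → ℝ}

theorem childSum_pos (hφ : ∀ v, 0 < φ v) {v : V} (hv : (below hT o v).Nonempty) :
    0 < childSum hT o φ v := Finset.sum_pos (fun _ _ => hφ _) hv

theorem children_nonempty {v : V} (hv : (below hT o v).Nonempty) : (children T o v).Nonempty := by
  obtain ⟨e, he⟩ := hv
  exact ⟨far T o e, (children_eq_image hT o v).symm.subset ⟨e, mem_below.1 he, rfl⟩⟩

theorem isProbabilityMeasure_gasChildLaw [MeasurableSpace V] [DiscreteMeasurableSpace V]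
    (hφ : ∀ v, 0 < φ v) {v : V} (hv : (below hT o v).Nonempty) :
    IsProbabilityMeasure (gasChildLaw hT o S φ v) := by
  unfold gasChildLaw
  split_ifs
  · have hq := childSum_pos hφ hv
    constructor
    simp only [Measure.coe_finsetSum, Finset.sum_apply, Measure.smul_apply, measure_univ,
      smul_eq_mul, mul_one]
    rw [← ENNReal.ofReal_sum_of_nonneg (fun e _ => (div_pos (hφ _) hq).le), ← Finset.sum_div]
    change ENNReal.ofReal (childSum hT o φ v / childSum hT o φ v) = 1
    rw [div_self hq.ne', ENNReal.ofReal_one]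
  · exact isProbabilityMeasure_uniformOn (finite_children o v) (children_nonempty hv)

theorem ae_mem_children_uniformOn [MeasurableSpace V] [DiscreteMeasurableSpace V] {v : V}
    (hv : (below hT o v).Nonempty) :
    ∀ᵐ w ∂(uniformOn (children T o v)), w ∈ children T o v := by
  have := isProbabilityMeasure_uniformOn (finite_children (T := T) o v) (children_nonempty hv)
  exact (mem_ae_iff_prob_eq_one MeasurableSet.of_discrete).2
    (uniformOn_self (finite_children o v) (children_nonempty hv))

theorem ae_mem_children_gasChildLaw [MeasurableSpace V] [DiscreteMeasurableSpace V] {v : V}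
    (hv : (below hT o v).Nonempty) :
    ∀ᵐ w ∂(gasChildLaw hT o S φ v), w ∈ children T o v := by
  unfold gasChildLaw
  split_ifs
  · rw [ae_iff]
    simp only [Measure.coe_finsetSum, Finset.sum_apply, Measure.smul_apply, smul_eq_mul]
    refine Finset.sum_eq_zero fun e he => ?_
    rw [Measure.dirac_apply' _ MeasurableSet.of_discrete, Set.indicator_of_notMem, mul_zero]
    rw [Set.mem_ofPred_eq, not_not]
    exact (children_eq_image hT o v).symm.subset ⟨e, mem_below.1 he, rfl⟩
  · exact ae_mem_children_uniformOn hv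

theorem gasChildLaw_real_singleton [MeasurableSpace V] [DiscreteMeasurableSpace V]
    (hφ : ∀ v, 0 < φ v) {v : V} (hvS : v ∈ S) {e : T.edgeSet} (he : e ∈ below hT o v) :
    (gasChildLaw hT o S φ v).real {far T o e} = φ (far T o e) / childSum hT o φ v := by
  classical
  have hq := childSum_pos hφ ⟨e, he⟩
  rw [gasChildLaw, if_pos hvS, measureReal_def]
  simp only [Measure.coe_finsetSum, Finset.sum_apply, Measure.smul_apply, smul_eq_mul]
  rw [Finset.sum_eq_single_of_mem e he]
  · rw [Measure.dirac_apply' _ MeasurableSet.of_discrete, Set.indicator_of_mem (Set.mem_singleton _), Pi.one_apply,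
      mul_one, ENNReal.toReal_ofReal (div_pos (hφ _) hq).le]
  · intro e' _ hne
    rw [Measure.dirac_apply' _ MeasurableSet.of_discrete, Set.indicator_of_notMem, mul_zero]
    exact fun h => hne (far_injective hT o h)

/-! ### Telescoping of the transition weights -/

open Classical in
/-- The factor `q`, the sum of the exit odds of the children, attached to a vertex of `τ`. It is
collected at the edge above the vertex and used up by the choice among the edges below it. -/
def oddsFactor (hT : T.IsTree) (o : V) (φ : V → ℝ) (τ : Finset V) (v : V) : ℝ :=
  if v ∈ τ then childSum hT o φ v else 1

open Classical in
/-- The contribution of an edge and of its further endpoint to the weight of `(G, τ)`. All boundary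
vertices have to be in `τ`. -/
def edgeFactor (hT : T.IsTree) (o : V) (S : Finset V) (β : ℝ) (φ : V → ℝ) (G : Finset T.edgeSet)
    (τ : Finset V) (e : T.edgeSet) : ℝ :=
  (if e ∈ G then β else 1) *
    if far T o e ∈ S then oddsFactor hT o φ τ (far T o e) / (1 + β + childSum hT o φ (far T o e))
    else if far T o e ∈ τ then 1 else 0

/-- The pair `(G, τ)` is consistent at `u`: `u` lies in `τ` if and only if an edge of `G` leads to a
child in `τ`, and there is at most one such edge. -/
def ConsistentAt (T : SimpleGraph V) (o : V) (G : Finset T.edgeSet) (τ : Finset V) (u : V) : Prop :=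
  (u ∈ τ ↔ ∃ e ∈ G, near T o e = u ∧ far T o e ∈ τ) ∧
    ∀ e ∈ G, ∀ e' ∈ G, near T o e = u → near T o e' = u → far T o e ∈ τ → far T o e' ∈ τ → e = e'

variable {G : Finset T.edgeSet} {τ : Finset V}

/-- An edge that is not used by a trail contributes its `edgeFactor`. -/
theorem edgeWeight_false (hβ : 0 < β) (hφ : ∀ v, 0 < φ v)
    (hb : ∀ v, (below hT o v).Nonempty) {e : T.edgeSet} (he : ¬ (e ∈ G ∧ far T o e ∈ τ)) :
    edgeWeight T o (gasEdgeProb hT o S β φ) (gasVertexProb hT o S φ) G τ False e =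
      edgeFactor hT o S β φ G τ e := by
  have hq := childSum_pos hφ (hb (far T o e))
  set q := childSum hT o φ (far T o e) with hqdef
  have h1 : 0 < 1 + β + q := by linarith
  have c1 : (clampUnit (β / (1 + β + q)) : ℝ) = β / (1 + β + q) :=
    coe_clampUnit (by positivity) ((div_le_one h1).2 (by linarith))
  have c2 : (clampUnit (q / (1 + q)) : ℝ) = q / (1 + q) :=
    coe_clampUnit (by positivity) ((div_le_one (by linarith)).2 (by linarith))
  have c3 : 1 - β / (1 + β + q) = (1 + q) / (1 + β + q) := by
    rw [eq_div_iff h1.ne', sub_mul, div_mul_cancel₀ _ h1.ne']; ring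
  have c4 : 1 - q / (1 + q) = 1 / (1 + q) := by
    rw [eq_div_iff (by linarith), sub_mul, div_mul_cancel₀ _ (by linarith)]; ring
  have h2 : 1 + q ≠ 0 := by linarith
  unfold edgeWeight edgeFactor gasEdgeProb gasVertexProb oddsFactor
  by_cases hG : e ∈ G <;> by_cases ht : far T o e ∈ τ <;> by_cases hs : far T o e ∈ S <;>
    simp only [hG, ht, hs, if_true, if_false, ← hqdef, c1, c2, c3, c4]
  · exact absurd ⟨hG, ht⟩ he
  · exact absurd ⟨hG, ht⟩ he
  · ring
  · simp
  · field_simp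
  · simp
  · field_simp
  · simp

/-- The recursion for the exit odds says that an edge used by a trail contributes the exit odds of
its further endpoint. -/
theorem edgeFactor_of_active (hφ : IsExitOdds hT o S β φ) {e : T.edgeSet}
    (he : e ∈ G ∧ far T o e ∈ τ) : edgeFactor hT o S β φ G τ e = φ (far T o e) := by
  unfold edgeFactor oddsFactor
  by_cases hs : far T o e ∈ S
  · rw [if_pos he.1, if_pos hs, if_pos he.2, hφ.of_mem _ hs, mul_div_assoc]
  · rw [if_pos he.1, if_neg hs, if_pos he.2, hφ.of_notMem _ hs, mul_one]

theorem prod_of_isRooted {M : Type*} [CommMonoid M] [DecidableEq V] (hS : IsRooted T o S)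
    (f : V → M) :
    ∏ v ∈ S, f v = f o * ∏ e ∈ edgesFrom hT o S, if far T o e ∈ S then f (far T o e) else 1 := by
  have h1 : ∏ v ∈ S, f v = ∏ v ∈ withChildren hT o S, if v ∈ S then f v else 1 := by
    rw [Finset.prod_ite_mem, Finset.inter_eq_right.2 fun v hv => mem_withChildren_of_mem hS hv]
  rw [h1, prod_withChildren, if_pos hS.root_mem]

/-- The normalising constant of the product of the transition weights. -/
def gasNorm (hT : T.IsTree) (o : V) (S : Finset V) (β : ℝ) (φ : V → ℝ) : ℝ :=
  open Classical in (1 + childSum hT o φ o) * ∏ e ∈ edgesFrom hT o S,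
    if far T o e ∈ S then 1 + β + childSum hT o φ (far T o e) else 1

theorem gasNorm_pos (hβ : 0 < β) (hφ : ∀ v, 0 < φ v) (hb : ∀ v, (below hT o v).Nonempty) :
    0 < gasNorm hT o S β φ := by
  have hq : ∀ v, 0 < childSum hT o φ v := fun v => childSum_pos hφ (hb v)
  refine mul_pos (by linarith [hq o]) (Finset.prod_pos fun e _ => ?_)
  split_ifs
  · linarith [hq (far T o e)]
  · exact one_pos

variable [MeasurableSpace V]

theorem vertexWeight_of_notMem {p : T.edgeSet → unitInterval} {r : V → unitInterval}
    {ν : V → Measure V} {u : V} (hu : u ∉ τ) :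
    vertexWeight hT o p r ν G τ u = (∑ e ∈ below hT o u, (ν u).real {far T o e}) *
      ∏ e ∈ below hT o u, edgeWeight T o p r G τ False e := by
  simp only [vertexWeight, hu, false_and, Finset.sum_mul]

theorem vertexWeight_of_not_consistentAt {p : T.edgeSet → unitInterval} {r : V → unitInterval}
    {ν : V → Measure V} {u : V} (hc : ¬ ConsistentAt T o G τ u) :
    vertexWeight hT o p r ν G τ u = 0 := by
  classical
  refine Finset.sum_eq_zero fun e he => mul_eq_zero_of_right _ ?_
  by_contra hne
  rw [← ne_eq, Finset.prod_ne_zero_iff] at hne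
  refine hc ?_
  -- an edge of `G` to a child in `τ` can only be the chosen one, and then `u ∈ τ`
  have h1 : ∀ e' ∈ G, near T o e' = u → far T o e' ∈ τ → u ∈ τ ∧ e' = e := by
    intro e' h1 h2 h3
    by_contra h
    refine hne e' (mem_below.2 h2) ?_
    rw [show (u ∈ τ ∧ e' = e) = False from eq_false h]
    exact edgeWeight_false_of_active ⟨h1, h3⟩
  refine ⟨⟨fun hu => ?_, fun ⟨e', h2, h3, h4⟩ => (h1 e' h2 h3 h4).1⟩,
    fun e1 g1 e2 g2 n1 n2 t1 t2 => (h1 e1 g1 n1 t1).2.trans (h1 e2 g2 n2 t2).2.symm⟩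
  by_contra h
  refine hne e he (edgeWeight_true_of_not ⟨hu, rfl⟩ fun h' => h ?_)
  exact ⟨e, h'.1, mem_below.1 he, h'.2⟩

variable [DiscreteMeasurableSpace V]

/-- At a vertex of `τ`, the factor `q` cancels the denominator in the law `φ / q` of the chosen child. -/
theorem vertexWeight_of_consistentAt (hβ : 0 < β) (hφ : IsExitOdds hT o S β φ)
    (hb : ∀ v, (below hT o v).Nonempty) {u : V} (hu : u ∈ S) (hc : ConsistentAt T o G τ u) :
    vertexWeight hT o (gasEdgeProb hT o S β φ) (gasVertexProb hT o S φ) (gasChildLaw hT o S φ)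
      G τ u * oddsFactor hT o φ τ u = ∏ e ∈ below hT o u, edgeFactor hT o S β φ G τ e := by
  classical
  have hq := childSum_pos hφ.pos (hb u)
  by_cases hut : u ∈ τ
  · obtain ⟨e, heG, hen, het⟩ := hc.1.1 hut
    have heb : e ∈ below hT o u := mem_below.2 hen
    rw [oddsFactor, if_pos hut, vertexWeight, Finset.sum_eq_single_of_mem e heb]
    · rw [gasChildLaw_real_singleton hφ.pos hu heb, ← Finset.mul_prod_erase _ _ heb,
        ← Finset.mul_prod_erase _ _ heb, edgeWeight_true ⟨hut, rfl⟩ ⟨heG, het⟩,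
        edgeFactor_of_active hφ ⟨heG, het⟩]
      have : ∀ e' ∈ (below hT o u).erase e, edgeWeight T o (gasEdgeProb hT o S β φ)
          (gasVertexProb hT o S φ) G τ (u ∈ τ ∧ e' = e) e' = edgeFactor hT o S β φ G τ e' := by
        intro e' he'
        obtain ⟨hne, he'⟩ := Finset.mem_erase.1 he'
        rw [show (u ∈ τ ∧ e' = e) = False from eq_false fun h => hne h.2]
        refine edgeWeight_false hβ hφ.pos hb fun h => hne ?_
        exact hc.2 e' h.1 e heG (mem_below.1 he') hen h.2 het
      rw [Finset.prod_congr rfl this]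
      field_simp
    · intro e' he' hne
      refine mul_eq_zero_of_right _ (Finset.prod_eq_zero heb ?_)
      rw [show (u ∈ τ ∧ e = e') = False from eq_false fun h => hne h.2.symm]
      exact edgeWeight_false_of_active ⟨heG, het⟩
  · have hsum : ∑ e ∈ below hT o u, (gasChildLaw hT o S φ u).real {far T o e} = 1 := by
      rw [Finset.sum_congr rfl fun e he => gasChildLaw_real_singleton hφ.pos hu he,
        ← Finset.sum_div]
      exact div_self hq.ne'
    rw [vertexWeight_of_notMem hut, hsum, one_mul, oddsFactor, if_neg hut, mul_one]
    refine Finset.prod_congr rfl fun e he => edgeWeight_false hβ hφ.pos hb fun h => hut ?_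
    exact hc.1.2 ⟨e, h.1, mem_below.1 he, h.2⟩

/-- The product of the transition weights telescopes: on consistent pairs `(G, τ)` it is
proportional to `β ^ |G|`. -/
theorem weight_of_consistent (hβ : 0 < β) (hφ : IsExitOdds hT o S β φ)
    (hb : ∀ v, (below hT o v).Nonempty) (hS : IsRooted T o S) (hG : G ⊆ edgesFrom hT o S)
    (hc : ∀ u ∈ S, ConsistentAt T o G τ u)
    (hout : ∀ e ∈ edgesFrom hT o S, far T o e ∉ S → far T o e ∈ τ) :
    rootWeight o (gasVertexProb hT o S φ) τ * ∏ u ∈ S, vertexWeight hT o (gasEdgeProb hT o S β φ)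
      (gasVertexProb hT o S φ) (gasChildLaw hT o S φ) G τ u = β ^ G.card / gasNorm hT o S β φ := by
  classical
  have hq : ∀ v, 0 < childSum hT o φ v := fun v => childSum_pos hφ.pos (hb v)
  have hodds : ∀ v, 0 < oddsFactor hT o φ τ v := fun v => by
    unfold oddsFactor
    split_ifs
    · exact hq v
    · exact one_pos
  have h1 : (∏ u ∈ S, vertexWeight hT o (gasEdgeProb hT o S β φ)
      (gasVertexProb hT o S φ) (gasChildLaw hT o S φ) G τ u) * ∏ u ∈ S, oddsFactor hT o φ τ u =
      ∏ e ∈ edgesFrom hT o S, edgeFactor hT o S β φ G τ e := by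
    rw [← Finset.prod_mul_distrib, prod_edgesFrom]
    exact Finset.prod_congr rfl fun u hu => vertexWeight_of_consistentAt hβ hφ hb hu (hc u hu)
  have h2 : ∏ e ∈ edgesFrom hT o S, edgeFactor hT o S β φ G τ e = β ^ G.card *
      ((∏ e ∈ edgesFrom hT o S, if far T o e ∈ S then oddsFactor hT o φ τ (far T o e) else 1) /
      ∏ e ∈ edgesFrom hT o S, if far T o e ∈ S then 1 + β + childSum hT o φ (far T o e) else 1) := by
    rw [← Finset.prod_div_distrib]
    unfold edgeFactor
    rw [Finset.prod_mul_distrib]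
    congr 1
    · rw [Finset.prod_ite_mem, Finset.inter_eq_right.2 hG, Finset.prod_const]
    · refine Finset.prod_congr rfl fun e he => ?_
      by_cases hs : far T o e ∈ S
      · simp only [if_pos hs]
      · simp only [if_neg hs, if_pos (hout e he hs), div_one]
  have h3 := prod_of_isRooted (hT := hT) hS (oddsFactor hT o φ τ)
  have h4 : rootWeight o (gasVertexProb hT o S φ) τ =
      oddsFactor hT o φ τ o / (1 + childSum hT o φ o) := by
    have hqo := hq o
    have c2 : (clampUnit (childSum hT o φ o / (1 + childSum hT o φ o)) : ℝ)
        = childSum hT o φ o / (1 + childSum hT o φ o) :=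
      coe_clampUnit (by positivity) ((div_le_one (by linarith)).2 (by linarith))
    unfold rootWeight oddsFactor gasVertexProb
    rw [if_pos hS.root_mem, c2]
    split_ifs
    · rfl
    · rw [eq_div_iff (by linarith), sub_mul, div_mul_cancel₀ _ (by linarith)]; ring
  rw [h2, h3] at h1
  set A := ∏ e ∈ edgesFrom hT o S,
    if far T o e ∈ S then oddsFactor hT o φ τ (far T o e) else 1 with hA
  have hApos : 0 < A := Finset.prod_pos fun e _ => by
    split_ifs
    · exact hodds _
    · exact one_pos
  have hN := gasNorm_pos (S := S) hβ hφ.pos hb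
  unfold gasNorm at hN ⊢
  set D := ∏ e ∈ edgesFrom hT o S,
    if far T o e ∈ S then 1 + β + childSum hT o φ (far T o e) else 1 with hD
  have ho := hodds o
  have hqo : 0 < 1 + childSum hT o φ o := by linarith [hq o]
  have hDpos : 0 < D := pos_of_mul_pos_right hN hqo.le
  rw [h4]
  rw [eq_div_iff (by positivity)]
  have h5 : ∀ P : ℝ, P * (oddsFactor hT o φ τ o * A) = β ^ G.card * (A / D) →
      oddsFactor hT o φ τ o / (1 + childSum hT o φ o) * P * ((1 + childSum hT o φ o) * D) =
        β ^ G.card := by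
    intro P hP
    field_simp at hP ⊢
    linarith
  exact h5 _ h1

theorem weight_of_not_consistent (hβ : 0 < β) (hφ : IsExitOdds hT o S β φ)
    (hb : ∀ v, (below hT o v).Nonempty)
    (hc : ¬ ((∀ u ∈ S, ConsistentAt T o G τ u) ∧
      ∀ e ∈ edgesFrom hT o S, far T o e ∉ S → far T o e ∈ τ)) :
    rootWeight o (gasVertexProb hT o S φ) τ * ∏ u ∈ S, vertexWeight hT o (gasEdgeProb hT o S β φ)
      (gasVertexProb hT o S φ) (gasChildLaw hT o S φ) G τ u = 0 := by
  classical
  refine mul_eq_zero_of_right _ ?_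
  by_contra hne
  rw [← ne_eq, Finset.prod_ne_zero_iff] at hne
  have h1 : ∀ u ∈ S, ConsistentAt T o G τ u := fun u hu => by
    by_contra h
    exact hne u hu (vertexWeight_of_not_consistentAt h)
  refine hc ⟨h1, fun e he hs => ?_⟩
  by_contra ht
  have hu := mem_edgesFrom.1 he
  have h2 := vertexWeight_of_consistentAt hβ hφ hb hu (h1 _ hu)
  rw [Finset.prod_eq_zero (mem_below.2 rfl : e ∈ below hT o (near T o e))
    (by simp [edgeFactor, hs, ht])] at h2
  refine hne _ hu ((mul_eq_zero.1 h2).resolve_right ?_)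
  unfold oddsFactor
  split_ifs
  · exact (childSum_pos hφ.pos (hb _)).ne'
  · exact one_ne_zero

end GasParameters

/-! ### The arboreal gas as a superposition -/

section GasLaw

variable {V : Type*} {T : SimpleGraph V} [T.LocallyFinite] {hT : T.IsTree} {o : V}
variable {S : Finset V} {G : Finset T.edgeSet} {τ : Finset V}

/-- In a consistent pair `(G, τ)`, the set `τ` consists of the vertices from which `G` leads to the
boundary. -/
theorem mem_iff_reachesOut_of_consistent (hS : IsRooted T o S) (hG : G ⊆ edgesFrom hT o S)
    (hc : ∀ u ∈ S, ConsistentAt T o G τ u)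
    (hout : ∀ e ∈ edgesFrom hT o S, far T o e ∉ S → far T o e ∈ τ) {v : V}
    (hv : v ∈ withChildren hT o S) : v ∈ τ ↔ ReachesOut T o S G v := by
  constructor
  · -- induction on the distance to the deepest vertices of `S`
    have key : ∀ n, ∀ v, S.sup (T.dist o) + 1 ≤ T.dist o v + n → v ∈ τ → ReachesOut T o S G v := by
      intro n
      induction n with
      | zero =>
        intro v hn _
        refine .out v fun hvS => ?_
        have := Finset.le_sup (f := T.dist o) hvS
        omega
      | succ n ih =>
        intro v hn hv
        by_cases hvS : v ∈ S
        · obtain ⟨e, he, rfl, het⟩ := (hc v hvS).1.1 hv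
          exact .step e he (ih _ (by rw [dist_far hT]; omega) het)
        · exact .out v hvS
    exact key (S.sup (T.dist o) + 1) v (by omega)
  · intro h
    induction h with
    | out v hvS =>
      have hvo : v ≠ o := fun h => hvS (h ▸ hS.root_mem)
      obtain ⟨e, rfl⟩ := exists_far_eq hT hvo
      exact hout e (mem_edgesFrom.2 (far_mem_withChildren.1 hv)) hvS
    | step e he _ ih =>
      have hn := mem_edgesFrom.1 (hG he)
      exact (hc _ hn).1.2 ⟨e, he, rfl, ih (far_mem_withChildren.2 hn)⟩

open Classical in
/-- For a given `G` there is at most one `τ` such that the pair is consistent, and there is one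
exactly if `G` has unique exits, that is, if `G` is a forest of the wired graph. -/
theorem consistent_iff (hS : IsRooted T o S) (hG : G ⊆ edgesFrom hT o S)
    (hτ : τ ⊆ withChildren hT o S) :
    ((∀ u ∈ S, ConsistentAt T o G τ u) ∧
      ∀ e ∈ edgesFrom hT o S, far T o e ∉ S → far T o e ∈ τ) ↔
    UniqueExits T o S G ∧ τ = (withChildren hT o S).filter (ReachesOut T o S G) := by
  constructor
  · rintro ⟨hc, hout⟩
    have hmem := fun v hv => mem_iff_reachesOut_of_consistent (v := v) hS hG hc hout hv
    refine ⟨fun e he e' he' hn h h' => ?_, ?_⟩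
    · have h1 := mem_edgesFrom.1 (hG he)
      have h1' := mem_edgesFrom.1 (hG he')
      exact (hc _ h1).2 e he e' he' rfl hn.symm ((hmem _ (far_mem_withChildren.2 h1)).2 h)
        ((hmem _ (far_mem_withChildren.2 h1')).2 h')
    · ext v
      rw [Finset.mem_filter]
      exact ⟨fun h => ⟨hτ h, (hmem v (hτ h)).1 h⟩, fun h => (hmem v h.1).2 h.2⟩
  · rintro ⟨hU, rfl⟩
    have hfar : ∀ e ∈ G, (far T o e ∈ (withChildren hT o S).filter (ReachesOut T o S G) ↔
        ReachesOut T o S G (far T o e)) := by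
      intro e he
      simp [Finset.mem_filter, far_mem_withChildren, mem_edgesFrom.1 (hG he)]
    refine ⟨fun u hu => ⟨?_, ?_⟩, fun e he hs => ?_⟩
    · rw [Finset.mem_filter, and_iff_right (mem_withChildren_of_mem hS hu), reachesOut_iff hu]
      refine exists_congr fun e => and_congr_right fun he => ?_
      rw [hfar e he]
    · intro e he e' he' hn hn' h h'
      exact hU e he e' he' (hn.trans hn'.symm) ((hfar e he).1 h) ((hfar e' he').1 h')
    · exact Finset.mem_filter.2 ⟨far_mem_withChildren.2 (mem_edgesFrom.1 he), .out _ hs⟩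

variable {β : ℝ} {φ : V → ℝ}

open Classical in
/-- With the gas parameters, the superposed configuration restricted to the edges of the wired graph
is almost surely a forest, and a forest `G` has probability proportional to `β ^ |G|`. -/
theorem superposedLaw_gas_real_cylinderOn [MeasurableSpace V] [DiscreteMeasurableSpace V]
    [Countable V] (hβ : 0 < β) (hφ : IsExitOdds hT o S β φ) (hb : ∀ v, (below hT o v).Nonempty)
    (hS : IsRooted T o S) (hG : G ⊆ edgesFrom hT o S) :
    (superposedLaw T o (gasEdgeProb hT o S β φ) (gasVertexProb hT o S φ)
      (gasChildLaw hT o S φ)).real (cylinderOn (edgesFrom hT o S) G) =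
    if (wiredGraph T S).IsForest (G : Set T.edgeSet) then β ^ G.card / gasNorm hT o S β φ
    else 0 := by
  have : ∀ v, IsProbabilityMeasure (gasChildLaw hT o S φ v) := fun v =>
    isProbabilityMeasure_gasChildLaw hφ.pos (hb v)
  rw [superposedLaw_real_cylinderOn _ _ _ (fun v => ae_mem_children_gasChildLaw (hb v)) hS]
  have hterm : ∀ τ ∈ (withChildren hT o S).powerset,
      rootWeight o (gasVertexProb hT o S φ) τ * ∏ u ∈ S, vertexWeight hT o (gasEdgeProb hT o S β φ)
        (gasVertexProb hT o S φ) (gasChildLaw hT o S φ) G τ u =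
      if τ = (withChildren hT o S).filter (ReachesOut T o S G) then
        (if UniqueExits T o S G then β ^ G.card / gasNorm hT o S β φ else 0) else 0 := by
    intro τ hτ
    have hiff := consistent_iff hS hG (Finset.mem_powerset.1 hτ)
    by_cases hc : (∀ u ∈ S, ConsistentAt T o G τ u) ∧
      ∀ e ∈ edgesFrom hT o S, far T o e ∉ S → far T o e ∈ τ
    · rw [weight_of_consistent hβ hφ hb hS hG hc.1 hc.2, if_pos (hiff.1 hc).2,
        if_pos (hiff.1 hc).1]
    · rw [weight_of_not_consistent hβ hφ hb hc]
      by_cases h1 : τ = (withChildren hT o S).filter (ReachesOut T o S G)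
      · rw [if_pos h1, if_neg fun h2 => hc (hiff.2 ⟨h2, h1⟩)]
      · rw [if_neg h1]
  rw [Finset.sum_congr rfl hterm, Finset.sum_ite_eq' _ _ _,
    if_pos (Finset.mem_powerset.2 (Finset.filter_subset _ _))]
  have h := isForest_wiredGraph_iff hT hS (F := G)
  rw [and_iff_right fun e he => mem_edgesFrom.1 (hG he)] at h
  simp only [h]

/-- A cylinder event splits according to the configuration on a larger finite set. -/
theorem real_cylinderOn_eq_sum {ε : Type*} [DecidableEq ε] (μ : Measure (ε → Bool))
    [IsFiniteMeasure μ] {A B : Finset ε} (hAB : A ⊆ B) (G : Finset ε) :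
    μ.real (cylinderOn A G) =
      ∑ H ∈ B.powerset with (∀ e ∈ A, (e ∈ H ↔ e ∈ G)), μ.real (cylinderOn B H) := by
  classical
  rw [← measureReal_biUnion_finset]
  · congr 1
    ext ω
    simp only [Set.mem_iUnion, exists_prop, Finset.mem_filter, Finset.mem_powerset]
    constructor
    · intro h
      have hH : ∀ e ∈ B, (ω e = true ↔ e ∈ B.filter fun e => ω e = true) := fun e he => by
        simp [he]
      exact ⟨B.filter fun e => ω e = true, ⟨Finset.filter_subset _ _,
        fun e he => (hH e (hAB he)).symm.trans (h e he)⟩, hH⟩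
    · rintro ⟨H, ⟨-, h1⟩, h2⟩ e he
      exact (h2 e (hAB he)).trans (h1 e he)
  · intro H hH H' hH' hne
    rw [Finset.mem_coe, Finset.mem_filter, Finset.mem_powerset] at hH hH'
    refine Set.disjoint_left.2 fun ω h h' => hne ?_
    ext e
    by_cases he : e ∈ B
    · exact (h e he).symm.trans (h' e he)
    · exact ⟨fun h => absurd (hH.1 h) he, fun h => absurd (hH'.1 h) he⟩
  · exact fun H _ => measurableSet_cylinderOn B H

theorem real_cylinderOn_sum_powerset {ε : Type*} (μ : Measure (ε → Bool))
    [IsProbabilityMeasure μ] (B : Finset ε) : ∑ H ∈ B.powerset, μ.real (cylinderOn B H) = 1 := by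
  classical
  have h := real_cylinderOn_eq_sum μ (Finset.empty_subset B) ∅
  have h1 : cylinderOn (∅ : Finset ε) ∅ = Set.univ := by
    ext ω; simp [cylinderOn]
  rw [h1, probReal_univ] at h
  simpa using h.symm

theorem coe_toFinset_edgeSet_wiredGraph (hT : T.IsTree) (hS : IsRooted T o S) :
    (finite_edgeSet_wiredGraph T S).toFinset = edgesFrom hT o S := by
  ext e
  rw [Set.Finite.mem_toFinset, mem_edgeSet_wiredGraph_iff hT hS, mem_edgesFrom]

open Classical in
theorem wiredArborealGas_real_cylinderOn (hT : T.IsTree) (hβ : 0 < β) (hS : IsRooted T o S)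
    (hG : G ⊆ edgesFrom hT o S) :
    (wiredArborealGas T S β hβ : Measure (BondConfig T)).real (cylinderOn (edgesFrom hT o S) G) =
    if (wiredGraph T S).IsForest (G : Set T.edgeSet) then
      β ^ G.card / (wiredGraph T S).arborealPartition (finite_edgeSet_wiredGraph T S) β
    else 0 := by
  have hZ := (wiredGraph T S).arborealPartition_pos (finite_edgeSet_wiredGraph T S) hβ
  have hmem : ∀ F : Finset T.edgeSet, F ∈ (wiredGraph T S).forests (finite_edgeSet_wiredGraph T S) ↔
      F ⊆ edgesFrom hT o S ∧ (wiredGraph T S).IsForest (F : Set T.edgeSet) := by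
    intro F
    rw [Graph.forests, Finset.mem_filter, Finset.mem_powerset, coe_toFinset_edgeSet_wiredGraph hT hS]
  change ((wiredGraph T S).arborealMeasure (finite_edgeSet_wiredGraph T S) β).real _ = _
  rw [measureReal_def, Graph.arborealMeasure]
  simp only [Measure.coe_finsetSum, Finset.sum_apply, Measure.smul_apply, smul_eq_mul]
  have hdirac : ∀ F ∈ (wiredGraph T S).forests (finite_edgeSet_wiredGraph T S),
      ∀ ω : BondConfig T, (∀ e, ω e = true ↔ e ∈ F) →
        Measure.dirac ω (cylinderOn (edgesFrom hT o S) G) = if F = G then 1 else 0 := by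
    intro F hF ω hω
    rw [Measure.dirac_apply' _ (measurableSet_cylinderOn _ _)]
    have : ω ∈ cylinderOn (edgesFrom hT o S) G ↔ F = G := by
      simp only [cylinderOn, Set.mem_ofPred_eq, hω]
      refine ⟨fun h => ?_, fun h => by simp [h]⟩
      ext e
      by_cases he : e ∈ edgesFrom hT o S
      · exact h e he
      · exact ⟨fun h => absurd (((hmem F).1 hF).1 h) he, fun h => absurd (hG h) he⟩
    by_cases h : F = G
    · rw [Set.indicator_of_mem (this.2 h), if_pos h, Pi.one_apply]
    · rw [Set.indicator_of_notMem (fun h' => h (this.1 h')), if_neg h]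
  rw [Finset.sum_congr (g := fun F : Finset T.edgeSet => if F = G then ENNReal.ofReal (β ^ F.card /
      (wiredGraph T S).arborealPartition (finite_edgeSet_wiredGraph T S) β) else 0) rfl
    fun F hF => by rw [hdirac F hF _ (by simp), mul_ite, mul_one, mul_zero], Finset.sum_ite_eq']
  by_cases h : (wiredGraph T S).IsForest (G : Set T.edgeSet)
  · rw [if_pos h, if_pos ((hmem G).2 ⟨hG, h⟩), ENNReal.toReal_ofReal (by positivity)]
  · rw [if_neg h, if_neg fun h' => h ((hmem G).1 h').2, ENNReal.toReal_zero]

/-- On the edges of the wired graph, the arboreal gas is the law of the superposed configuration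
with the gas parameters: both give forests probabilities proportional to `β ^ |G|`, and the
normalising constants agree because both are probability measures. -/
theorem wiredArborealGas_real_cylinderOn_eq_superposedLaw [MeasurableSpace V] [DiscreteMeasurableSpace V]
    [Countable V] (hβ : 0 < β) (hφ : IsExitOdds hT o S β φ) (hb : ∀ v, (below hT o v).Nonempty)
    (hS : IsRooted T o S) {A : Finset T.edgeSet} (hA : A ⊆ edgesFrom hT o S)
    (G : Finset T.edgeSet) :
    (wiredArborealGas T S β hβ : Measure (BondConfig T)).real (cylinderOn A G) =
      (superposedLaw T o (gasEdgeProb hT o S β φ) (gasVertexProb hT o S φ)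
        (gasChildLaw hT o S φ)).real (cylinderOn A G) := by
  classical
  have : ∀ v, IsProbabilityMeasure (gasChildLaw hT o S φ v) := fun v =>
    isProbabilityMeasure_gasChildLaw hφ.pos (hb v)
  have hprob : IsProbabilityMeasure (superposedLaw T o (gasEdgeProb hT o S β φ)
      (gasVertexProb hT o S φ) (gasChildLaw hT o S φ)) :=
    Measure.isProbabilityMeasure_map (measurable_superposition o).aemeasurable
  have hZ := (wiredGraph T S).arborealPartition_pos (finite_edgeSet_wiredGraph T S) hβ
  have hN := gasNorm_pos (hT := hT) (o := o) (S := S) hβ hφ.pos hb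
  set Z := (wiredGraph T S).arborealPartition (finite_edgeSet_wiredGraph T S) β
  set N := gasNorm hT o S β φ
  set W := ∑ H ∈ (edgesFrom hT o S).powerset,
    if (wiredGraph T S).IsForest (H : Set T.edgeSet) then β ^ H.card else 0
  have h1 : W / Z = 1 := by
    rw [← real_cylinderOn_sum_powerset (wiredArborealGas T S β hβ : Measure (BondConfig T))
      (edgesFrom hT o S), Finset.sum_div]
    refine Finset.sum_congr rfl fun H hH => ?_
    rw [wiredArborealGas_real_cylinderOn hT hβ hS (Finset.mem_powerset.1 hH), ite_div, zero_div]
  have h2 : W / N = 1 := by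
    rw [← real_cylinderOn_sum_powerset (superposedLaw T o (gasEdgeProb hT o S β φ)
      (gasVertexProb hT o S φ) (gasChildLaw hT o S φ)) (edgesFrom hT o S), Finset.sum_div]
    refine Finset.sum_congr rfl fun H hH => ?_
    rw [superposedLaw_gas_real_cylinderOn hβ hφ hb hS (Finset.mem_powerset.1 hH), ite_div, zero_div]
  have hZN : Z = N := ((div_eq_one_iff_eq hZ.ne').1 h1).symm.trans ((div_eq_one_iff_eq hN.ne').1 h2)
  rw [real_cylinderOn_eq_sum _ hA, real_cylinderOn_eq_sum _ hA]
  refine Finset.sum_congr rfl fun H hH => ?_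
  have hH' := Finset.mem_powerset.1 (Finset.mem_filter.1 hH).1
  rw [wiredArborealGas_real_cylinderOn hT hβ hS hH',
    superposedLaw_gas_real_cylinderOn hβ hφ hb hS hH']
  change (if _ then _ / Z else 0) = if _ then _ / N else 0
  rw [hZN]

end GasLaw

/-! ### Exhaustions -/

section Exhaustions

variable {V : Type*} {T : SimpleGraph V} {o : V}

theorem IsExhaustion.eventually_mem {S : ℕ → Finset V} (hS : IsExhaustion T S) (v : V) :
    ∀ᶠ n in atTop, v ∈ S n := by
  obtain ⟨n, hn⟩ := hS.exhausts v
  exact eventually_atTop.2 ⟨n, fun m hm => hS.monotone hm hn⟩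

theorem IsExhaustion.eventually_subset {S : ℕ → Finset V} (hS : IsExhaustion T S) {A : Set V}
    (hA : A.Finite) : ∀ᶠ n in atTop, ∀ v ∈ A, v ∈ S n :=
  (eventually_all_finite hA).2 fun v _ => hS.eventually_mem v

/-- A finite connected set of vertices of a tree containing the root is closed under taking
parents. -/
theorem isRooted_of_connected (hT : T.IsTree) {S : Finset V} (ho : o ∈ S)
    (hS : (T.induce (S : Set V)).Connected) : IsRooted T o S := by
  classical
  refine ⟨ho, fun e he => ?_⟩
  obtain ⟨w⟩ := hS.preconnected ⟨o, ho⟩ ⟨far T o e, he⟩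
  let f : T.induce (S : Set V) →g T := ⟨Subtype.val, fun h => h⟩
  let p : T.Walk o (far T o e) := w.map f
  have hp : ∀ v ∈ p.bypass.support, v ∈ S := by
    intro v hv
    have hv := SimpleGraph.Walk.support_bypass_subset_support _ hv
    rw [SimpleGraph.Walk.support_map, List.mem_map] at hv
    obtain ⟨x, -, rfl⟩ := hv
    exact x.2
  obtain ⟨q, hq, hl⟩ := hT.connected.exists_path_of_dist o (near T o e)
  have h1 : (q.concat (adj_near_far hT o e)).IsPath :=
    SimpleGraph.Walk.isPath_of_length_eq_dist _ (by
      rw [SimpleGraph.Walk.length_concat, hl, dist_far hT])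
  have h2 := (hT.existsUnique_path o (far T o e)).unique h1 p.bypass_isPath
  refine hp _ ?_
  rw [← h2, SimpleGraph.Walk.support_concat]
  simp

end Exhaustions

/-! ### Exit odds -/

section ExitOdds

variable {V : Type*} {T : SimpleGraph V} [T.LocallyFinite] {hT : T.IsTree} {o : V}

/-- The map that yields the exit odds of a vertex, seen from its parent, from the sum `q` of the
exit odds of its children. -/
def oddsMap (β q : ℝ) : ℝ := β * q / (1 + β + q)

theorem oddsMap_mono {β q q' : ℝ} (hβ : 0 < β) (hq : 0 ≤ q) (h : q ≤ q') :
    oddsMap β q ≤ oddsMap β q' := by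
  unfold oddsMap
  rw [div_le_div_iff₀ (by linarith) (by linarith)]
  nlinarith [mul_nonneg hβ.le (sub_nonneg.2 h), mul_nonneg (mul_nonneg hβ.le hβ.le) (sub_nonneg.2 h)]

theorem oddsMap_le {β q : ℝ} (hβ : 0 < β) (hq : 0 ≤ q) : oddsMap β q ≤ β := by
  unfold oddsMap
  rw [div_le_iff₀ (by linarith)]
  nlinarith

theorem oddsMap_pos {β q : ℝ} (hβ : 0 < β) (hq : 0 < q) : 0 < oddsMap β q := by
  unfold oddsMap
  positivity

open Classical in
/-- Approximations of the exit odds, computed from the `n` generations below a vertex. -/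
def exitOddsApprox (hT : T.IsTree) (o : V) (S : Finset V) (β : ℝ) : ℕ → V → ℝ
  | 0, _ => β
  | n + 1, v => if v ∈ S then oddsMap β (childSum hT o (exitOddsApprox hT o S β n) v) else β

variable {S : Finset V} {β : ℝ}

theorem exitOddsApprox_pos (hβ : 0 < β) (hb : ∀ v, (below hT o v).Nonempty) (n : ℕ) (v : V) :
    0 < exitOddsApprox hT o S β n v := by
  induction n generalizing v with
  | zero => exact hβ
  | succ n ih =>
    rw [exitOddsApprox]
    split_ifs
    · exact oddsMap_pos hβ (childSum_pos ih (hb v))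
    · exact hβ

theorem exitOddsApprox_stable (n : ℕ) (v : V) (h : S.sup (T.dist o) + 1 ≤ T.dist o v + n) :
    exitOddsApprox hT o S β (n + 1) v = exitOddsApprox hT o S β n v := by
  induction n generalizing v with
  | zero =>
    rw [exitOddsApprox, exitOddsApprox, if_neg]
    intro hv
    have := Finset.le_sup (f := T.dist o) hv
    omega
  | succ n ih =>
    rw [exitOddsApprox, exitOddsApprox]
    have : childSum hT o (exitOddsApprox hT o S β (n + 1)) v
        = childSum hT o (exitOddsApprox hT o S β n) v :=
      Finset.sum_congr rfl fun e he => ih _ (by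
        rw [dist_far hT, mem_below.1 he]; omega)
    rw [this]

/-- The exit odds of the finite set `S`. So many generations leave `S` below every vertex. -/
def exitOdds (hT : T.IsTree) (o : V) (S : Finset V) (β : ℝ) : V → ℝ :=
  exitOddsApprox hT o S β (S.sup (T.dist o) + 1)

theorem exitOdds_pos (hβ : 0 < β) (hb : ∀ v, (below hT o v).Nonempty) (v : V) :
    0 < exitOdds hT o S β v := exitOddsApprox_pos hβ hb _ v

theorem isExitOdds_exitOdds (hβ : 0 < β) (hb : ∀ v, (below hT o v).Nonempty) :
    IsExitOdds hT o S β (exitOdds hT o S β) where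
  pos := exitOdds_pos hβ hb
  of_mem v hv := by
    rw [exitOdds, ← exitOddsApprox_stable _ _ (by omega), exitOddsApprox, if_pos hv]
    rfl
  of_notMem v hv := by rw [exitOdds, exitOddsApprox, if_neg hv]

/-! ### Convergence of the exit odds -/

/-- The exit odds of an infinite regular tree, the largest fixed point of
`x ↦ oddsMap β ((k - 1) x)`. -/
def limitOdds (k : ℕ) (β : ℝ) : ℝ := max 0 (((k : ℝ) - 2) * β - 1) / ((k : ℝ) - 1)

/-- The exit odds of a vertex of a regular tree with `n` generations below it. -/
def oddsIterate (k : ℕ) (β : ℝ) : ℕ → ℝ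
  | 0 => β
  | n + 1 => oddsMap β (((k : ℝ) - 1) * oddsIterate k β n)

variable {k : ℕ}

theorem limitOdds_nonneg (hk : 3 ≤ k) : 0 ≤ limitOdds k β := by
  have hk' : (3 : ℝ) ≤ k := by exact_mod_cast hk
  exact div_nonneg (le_max_left _ _) (by linarith)

theorem mul_limitOdds (hk : 3 ≤ k) :
    ((k : ℝ) - 1) * limitOdds k β = max 0 (((k : ℝ) - 2) * β - 1) := by
  have hk' : (3 : ℝ) ≤ k := by exact_mod_cast hk
  rw [limitOdds, mul_div_cancel₀ _ (by linarith)]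

theorem limitOdds_le (hk : 3 ≤ k) (hβ : 0 < β) : limitOdds k β ≤ β := by
  have hk' : (3 : ℝ) ≤ k := by exact_mod_cast hk
  rw [limitOdds, div_le_iff₀ (by linarith)]
  refine max_le (by nlinarith) (by nlinarith)

theorem oddsMap_limitOdds (hk : 3 ≤ k) (hβ : 0 < β) :
    oddsMap β (((k : ℝ) - 1) * limitOdds k β) = limitOdds k β := by
  have hk' : (3 : ℝ) ≤ k := by exact_mod_cast hk
  rw [mul_limitOdds hk, limitOdds, oddsMap]
  rcases le_total (((k : ℝ) - 2) * β - 1) 0 with h | h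
  · rw [max_eq_left h]; simp
  · rw [max_eq_right h, div_eq_div_iff (by linarith) (by linarith)]
    ring

theorem limitOdds_le_oddsIterate (hk : 3 ≤ k) (hβ : 0 < β) (n : ℕ) :
    limitOdds k β ≤ oddsIterate k β n := by
  have hk' : (3 : ℝ) ≤ k := by exact_mod_cast hk
  have h0 := limitOdds_nonneg (β := β) hk
  induction n with
  | zero => exact limitOdds_le hk hβ
  | succ n ih =>
    rw [oddsIterate, ← oddsMap_limitOdds hk hβ]
    exact oddsMap_mono hβ (mul_nonneg (by linarith) h0)
      (mul_le_mul_of_nonneg_left ih (by linarith))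

theorem antitone_oddsIterate (hk : 3 ≤ k) (hβ : 0 < β) : Antitone (oddsIterate k β) := by
  have hk' : (3 : ℝ) ≤ k := by exact_mod_cast hk
  have hpos : ∀ n, 0 ≤ oddsIterate k β n := fun n =>
    (limitOdds_nonneg hk).trans (limitOdds_le_oddsIterate hk hβ n)
  refine antitone_nat_of_succ_le fun n => ?_
  induction n with
  | zero => exact oddsMap_le hβ (mul_nonneg (by linarith) (hpos 0))
  | succ n ih =>
    exact oddsMap_mono hβ (mul_nonneg (by linarith) (hpos _))
      (mul_le_mul_of_nonneg_left ih (by linarith))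

/-- The iterates decrease to the largest fixed point of the recursion. -/
theorem tendsto_oddsIterate (hk : 3 ≤ k) (hβ : 0 < β) :
    Tendsto (oddsIterate k β) atTop (𝓝 (limitOdds k β)) := by
  have hk' : (3 : ℝ) ≤ k := by exact_mod_cast hk
  have hbdd : BddBelow (Set.range (oddsIterate k β)) :=
    ⟨limitOdds k β, by rintro _ ⟨n, rfl⟩; exact limitOdds_le_oddsIterate hk hβ n⟩
  have hlim := tendsto_atTop_ciInf (antitone_oddsIterate hk hβ) hbdd
  set L := ⨅ n, oddsIterate k β n
  have hL : limitOdds k β ≤ L := ge_of_tendsto' hlim (limitOdds_le_oddsIterate hk hβ)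
  have hL0 := (limitOdds_nonneg hk).trans hL
  have hq : 0 ≤ ((k : ℝ) - 1) * L := mul_nonneg (by linarith) hL0
  have hfix : oddsMap β (((k : ℝ) - 1) * L) = L := by
    refine tendsto_nhds_unique ?_ ((tendsto_add_atTop_iff_nat 1).2 hlim)
    have h1 : Tendsto (fun n => ((k : ℝ) - 1) * oddsIterate k β n) atTop
        (𝓝 (((k : ℝ) - 1) * L)) := hlim.const_mul _
    exact (h1.const_mul β).div (h1.const_add (1 + β)) (by linarith)
  have : L ≤ limitOdds k β := by
    rcases hL0.eq_or_lt with h | h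
    · rw [← h]; exact limitOdds_nonneg hk
    · rw [oddsMap, div_eq_iff (by linarith)] at hfix
      have h1 : β * ((k : ℝ) - 1) = 1 + β + ((k : ℝ) - 1) * L := by
        have : L * (β * ((k : ℝ) - 1)) = L * (1 + β + ((k : ℝ) - 1) * L) := by linarith
        exact mul_left_cancel₀ h.ne' this
      rw [limitOdds, le_div_iff₀ (by linarith)]
      refine le_trans (le_of_eq ?_) (le_max_right _ _)
      linarith
  rwa [le_antisymm this hL] at hlim

theorem card_below_root (hreg : T.IsRegularOfDegree k) : (below hT o o).card = k := by
  rw [← ncard_edgesBelow_root hT hreg o, below,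
    Set.ncard_eq_toFinset_card _ (finite_edgesBelow hT o o)]

theorem card_below_far (hreg : T.IsRegularOfDegree k) (e : T.edgeSet) :
    (below hT o (far T o e)).card = k - 1 := by
  rw [← ncard_edgesBelow_far hT hreg o e, below,
    Set.ncard_eq_toFinset_card _ (finite_edgesBelow hT o _)]

theorem below_nonempty (hk : 3 ≤ k) (hreg : T.IsRegularOfDegree k) (v : V) :
    (below hT o v).Nonempty := by
  rw [← Finset.card_pos]
  by_cases hv : v = o
  · rw [hv, card_below_root hreg]; omega
  · obtain ⟨e, rfl⟩ := exists_far_eq hT hv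
    rw [card_below_far hreg]; omega

theorem childSum_far_mem_Icc (hk : 3 ≤ k) (hreg : T.IsRegularOfDegree k) {φ : V → ℝ}
    {e : T.edgeSet} {a b : ℝ}
    (h : ∀ e' ∈ below hT o (far T o e), a ≤ φ (far T o e') ∧ φ (far T o e') ≤ b) :
    ((k : ℝ) - 1) * a ≤ childSum hT o φ (far T o e) ∧
      childSum hT o φ (far T o e) ≤ ((k : ℝ) - 1) * b := by
  have hc : ((below hT o (far T o e)).card : ℝ) = (k : ℝ) - 1 := by
    rw [card_below_far hreg, Nat.cast_sub (by omega), Nat.cast_one]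
  rw [← hc, ← nsmul_eq_mul, ← nsmul_eq_mul]
  exact ⟨Finset.card_nsmul_le_sum _ _ _ fun e' he' => (h e' he').1,
    Finset.sum_le_card_nsmul _ _ _ fun e' he' => (h e' he').2⟩

variable {φ : V → ℝ}

/-- The exit odds are bounded below by the fixed point `limitOdds` of the recursion, since this holds
outside `S` and `oddsMap` is monotone. -/
theorem IsExitOdds.limitOdds_le (hk : 3 ≤ k) (hreg : T.IsRegularOfDegree k) (hβ : 0 < β)
    (hφ : IsExitOdds hT o S β φ) (e : T.edgeSet) : limitOdds k β ≤ φ (far T o e) := by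
  have hk' : (3 : ℝ) ≤ k := by exact_mod_cast hk
  have key : ∀ n, ∀ e, S.sup (T.dist o) + 1 ≤ T.dist o (far T o e) + n →
      limitOdds k β ≤ φ (far T o e) := by
    intro n
    induction n with
    | zero =>
      intro e hn
      rw [hφ.of_notMem]
      · exact _root_.limitOdds_le hk hβ
      · intro hv
        have := Finset.le_sup (f := T.dist o) hv
        omega
    | succ n ih =>
      intro e hn
      by_cases he : far T o e ∈ S
      · rw [hφ.of_mem _ he, ← oddsMap_limitOdds hk hβ]
        refine oddsMap_mono hβ (mul_nonneg (by linarith) (limitOdds_nonneg hk)) ?_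
        refine (childSum_far_mem_Icc (a := limitOdds k β) (b := ∑ e' ∈ below hT o (far T o e),
          φ (far T o e')) hk hreg fun e' he' => ⟨ih e' ?_, ?_⟩).1
        · rw [dist_far hT, mem_below.1 he']; omega
        · exact Finset.single_le_sum (fun e'' _ => (hφ.pos (far T o e'')).le) he'
      · rw [hφ.of_notMem _ he]
        exact _root_.limitOdds_le hk hβ
  exact key (S.sup (T.dist o) + 1) e (by omega)

/-- If `S` contains the next `n` generations, the exit odds are at most the `n`-th iterate of the
recursion started from the upper bound `β`. -/
theorem IsExitOdds.le_oddsIterate (hk : 3 ≤ k) (hreg : T.IsRegularOfDegree k) (hβ : 0 < β)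
    (hφ : IsExitOdds hT o S β φ) (n : ℕ) (e : T.edgeSet)
    (h : ∀ v, T.dist o v < T.dist o (far T o e) + n → v ∈ S) :
    φ (far T o e) ≤ oddsIterate k β n := by
  induction n generalizing e with
  | zero =>
    change φ (far T o e) ≤ β
    by_cases he : far T o e ∈ S
    · rw [hφ.of_mem _ he]
      exact oddsMap_le hβ (childSum_pos hφ.pos (below_nonempty hk hreg _)).le
    · rw [hφ.of_notMem _ he]
  | succ n ih =>
    rw [hφ.of_mem _ (h _ (by omega)), oddsIterate]
    refine oddsMap_mono hβ (childSum_pos hφ.pos (below_nonempty hk hreg _)).le ?_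
    refine (childSum_far_mem_Icc (a := 0) hk hreg fun e' he' => ⟨(hφ.pos _).le, ih e' ?_⟩).2
    intro v hv
    refine h v ?_
    rw [dist_far hT, mem_below.1 he'] at hv
    omega

theorem finite_dist_le (hT : T.IsTree) (o : V) (n : ℕ) : {v | T.dist o v ≤ n}.Finite := by
  induction n with
  | zero =>
    refine (Set.finite_singleton o).subset fun v hv => ?_
    exact (hT.connected.dist_eq_zero_iff.1 (Nat.le_zero.1 hv)).symm
  | succ n ih =>
    refine ((Set.finite_singleton o).union (ih.biUnion fun u _ =>
      (finite_edgesBelow hT o u).image (far T o))).subset fun v hv => ?_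
    by_cases hvo : v = o
    · exact Or.inl hvo
    · obtain ⟨e, rfl⟩ := exists_far_eq hT hvo
      refine Or.inr (Set.mem_biUnion (x := near T o e) ?_ ⟨e, rfl, rfl⟩)
      have hv : T.dist o (far T o e) ≤ n + 1 := hv
      rw [dist_far hT] at hv
      exact Nat.le_of_succ_le_succ hv

/-- Along an exhaustion, the exit odds converge to those of the infinite tree. -/
theorem tendsto_exitOdds (hk : 3 ≤ k) (hreg : T.IsRegularOfDegree k) (hβ : 0 < β)
    {S : ℕ → Finset V} (hS : IsExhaustion T S) (e : T.edgeSet) :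
    Tendsto (fun n => exitOdds hT o (S n) β (far T o e)) atTop (𝓝 (limitOdds k β)) := by
  have hφ : ∀ n, IsExitOdds hT o (S n) β (exitOdds hT o (S n) β) := fun n =>
    isExitOdds_exitOdds hβ (below_nonempty hk hreg)
  refine tendsto_order.2 ⟨fun a ha => ?_, fun a ha => ?_⟩
  · exact Eventually.of_forall fun n => ha.trans_le ((hφ n).limitOdds_le hk hreg hβ e)
  · obtain ⟨m, hm⟩ := ((tendsto_order.1 (tendsto_oddsIterate hk hβ)).2 a ha).exists
    filter_upwards [hS.eventually_subset (finite_dist_le hT o (T.dist o (far T o e) + m))]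
      with n hn
    exact ((hφ n).le_oddsIterate hk hreg hβ m e fun v hv => hn v hv.le).trans_lt hm

end ExitOdds

/-! ### Weak convergence and cylinder probabilities -/

section CylinderConvergence

theorem isPiSystem_cylinderOn (ε : Type*) :
    IsPiSystem {s : Set (ε → Bool) | ∃ A G : Finset ε, s = cylinderOn A G} := by
  classical
  rintro _ ⟨A, G, rfl⟩ _ ⟨A', G', rfl⟩ ⟨ω, h, h'⟩
  refine ⟨A ∪ A', (A ∪ A').filter fun e => ω e = true, ?_⟩
  ext ω'
  constructor
  · rintro ⟨g, g'⟩ e he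
    rw [Finset.mem_filter, and_iff_right he]
    rcases Finset.mem_union.1 he with he | he
    · exact (g e he).trans (h e he).symm
    · exact (g' e he).trans (h' e he).symm
  · intro g
    have g : ∀ e ∈ A ∪ A', (ω' e = true ↔ ω e = true) := fun e he => by
      rw [g e he, Finset.mem_filter, and_iff_right he]
    exact ⟨fun e he => (g e (Finset.mem_union_left _ he)).trans (h e he),
      fun e he => (g e (Finset.mem_union_right _ he)).trans (h' e he)⟩

theorem cylinderOn_mem_nhds {ε : Type*} (A G : Finset ε) {ω : ε → Bool}
    (hω : ω ∈ cylinderOn A G) : cylinderOn A G ∈ 𝓝 ω := by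
  have : cylinderOn A G = Set.pi A fun e => {b | b = true ↔ e ∈ G} := rfl
  rw [this]
  exact (isOpen_set_pi A.finite_toSet fun _ _ => isOpen_discrete _).mem_nhds hω

/-- Probability measures on configurations converge weakly if the probabilities of the
configurations on arbitrarily large finite sets of edges converge. -/
theorem tendsto_of_tendsto_cylinderOn {ε : Type*} [Countable ε]
    {μ : ℕ → ProbabilityMeasure (ε → Bool)} {ν : ProbabilityMeasure (ε → Bool)}
    (h : ∀ A : Finset ε, ∃ B, A ⊆ B ∧ ∀ G ⊆ B,
      Tendsto (fun n => (μ n : Measure (ε → Bool)).real (cylinderOn B G)) atTop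
        (𝓝 ((ν : Measure (ε → Bool)).real (cylinderOn B G)))) :
    Tendsto μ atTop (𝓝 ν) := by
  classical
  refine (isPiSystem_cylinderOn ε).tendsto_probabilityMeasure_of_tendsto_of_mem ?_ ?_ ?_
  · rintro _ ⟨A, G, rfl⟩
    exact measurableSet_cylinderOn A G
  · intro u hu ω hω
    obtain ⟨A, t, ht, hAt⟩ := isOpen_pi_iff.1 hu ω hω
    have hmem : ω ∈ cylinderOn A (A.filter fun e => ω e = true) := fun e he => by simp [he]
    refine ⟨_, ⟨A, A.filter fun e => ω e = true, rfl⟩, cylinderOn_mem_nhds _ _ hmem,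
      fun ω' h' => hAt fun e he => ?_⟩
    have : ω' e = ω e := Bool.eq_iff_iff.2 ((h' e he).trans (hmem e he).symm)
    rw [this]
    exact (ht e he).2
  · rintro _ ⟨A, G, rfl⟩
    obtain ⟨B, hAB, hB⟩ := h A
    have h1 : Tendsto (fun n => (μ n : Measure (ε → Bool)).real (cylinderOn A G)) atTop
        (𝓝 ((ν : Measure (ε → Bool)).real (cylinderOn A G))) := by
      simp only [real_cylinderOn_eq_sum _ hAB]
      exact tendsto_finsetSum _ fun H hH =>
        hB H (Finset.mem_powerset.1 (Finset.mem_filter.1 hH).1)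
    rw [← NNReal.tendsto_coe]
    exact h1

/-- Nonnegative numbers with sum `1` that are bounded below by convergent ones converge if the
limits of the lower bounds have sum `1`. -/
theorem tendsto_of_le_of_sum_eq_one {ι : Type*} {A : Finset ι} {f g : ℕ → ι → ℝ} {c : ι → ℝ}
    (hle : ∀ᶠ n in atTop, ∀ i ∈ A, g n i ≤ f n i) (hf : ∀ n, ∑ i ∈ A, f n i = 1)
    (hg : ∀ i ∈ A, Tendsto (fun n => g n i) atTop (𝓝 (c i))) (hc : ∑ i ∈ A, c i = 1)
    {i : ι} (hi : i ∈ A) : Tendsto (fun n => f n i) atTop (𝓝 (c i)) := by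
  classical
  have hup : Tendsto (fun n => 1 - ∑ j ∈ A.erase i, g n j) atTop
      (𝓝 (1 - ∑ j ∈ A.erase i, c j)) :=
    (tendsto_finsetSum _ fun j hj => hg j (Finset.mem_of_mem_erase hj)).const_sub 1
  have hci : 1 - ∑ j ∈ A.erase i, c j = c i := by
    rw [← hc, ← Finset.add_sum_erase _ _ hi]; ring
  rw [hci] at hup
  refine tendsto_of_tendsto_of_tendsto_of_le_of_le' (hg i hi) hup
    (hle.mono fun n hn => hn i hi) (hle.mono fun n hn => ?_)
  have h1 : ∑ j ∈ A.erase i, g n j ≤ ∑ j ∈ A.erase i, f n j :=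
    Finset.sum_le_sum fun j hj => hn j (Finset.mem_of_mem_erase hj)
  have h2 := hf n
  rw [← Finset.add_sum_erase _ _ hi] at h2
  linarith

end CylinderConvergence

/-! ### Convergence of the parameters -/

section ParameterConvergence

variable {V : Type*} {T : SimpleGraph V} [T.LocallyFinite] {hT : T.IsTree} {o : V}
variable {k : ℕ} {β : ℝ} {S : ℕ → Finset V}

theorem tendsto_childSum (hk : 3 ≤ k) (hreg : T.IsRegularOfDegree k) (hβ : 0 < β)
    (hS : IsExhaustion T S) (v : V) :
    Tendsto (fun n => childSum hT o (exitOdds hT o (S n) β) v) atTop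
      (𝓝 ((below hT o v).card * limitOdds k β)) := by
  rw [← nsmul_eq_mul, ← Finset.sum_const]
  exact tendsto_finsetSum _ fun e _ => tendsto_exitOdds hk hreg hβ hS e

theorem card_below_mul_limitOdds_nonneg (hk : 3 ≤ k) (v : V) :
    0 ≤ (below hT o v).card * limitOdds k β :=
  mul_nonneg (Nat.cast_nonneg _) (limitOdds_nonneg hk)

theorem tendsto_gasEdgeProb (hk : 3 ≤ k) (hreg : T.IsRegularOfDegree k) (hβ : 0 < β)
    (hS : IsExhaustion T S) (e : T.edgeSet) :
    Tendsto (fun n => (gasEdgeProb hT o (S n) β (exitOdds hT o (S n) β) e : ℝ)) atTop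
      (𝓝 (β / (1 + β + ((k : ℝ) - 1) * limitOdds k β))) := by
  have hk' : (3 : ℝ) ≤ k := by exact_mod_cast hk
  have h := tendsto_childSum (hT := hT) (o := o) hk hreg hβ hS (far T o e)
  have hc : ((below hT o (far T o e)).card : ℝ) = (k : ℝ) - 1 := by
    rw [card_below_far hreg, Nat.cast_sub (by omega), Nat.cast_one]
  rw [hc] at h
  have h0 : 0 ≤ ((k : ℝ) - 1) * limitOdds k β :=
    mul_nonneg (by linarith) (limitOdds_nonneg hk)
  refine ((tendsto_const_nhds (x := β)).div (h.const_add (1 + β)) (by linarith)).congr' ?_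
  filter_upwards [hS.eventually_mem (far T o e)] with n hn
  have hq := childSum_pos (hT := hT) (o := o) (φ := exitOdds hT o (S n) β)
    (exitOdds_pos hβ (below_nonempty hk hreg)) (below_nonempty hk hreg (far T o e))
  rw [gasEdgeProb, if_pos hn, coe_clampUnit (by positivity)
    ((div_le_one (by positivity)).2 (by linarith))]
  rfl

theorem tendsto_gasVertexProb (hk : 3 ≤ k) (hreg : T.IsRegularOfDegree k) (hβ : 0 < β)
    (hS : IsExhaustion T S) (v : V) :
    Tendsto (fun n => (gasVertexProb hT o (S n) (exitOdds hT o (S n) β) v : ℝ)) atTop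
      (𝓝 ((below hT o v).card * limitOdds k β / (1 + (below hT o v).card * limitOdds k β))) := by
  have h := tendsto_childSum (hT := hT) (o := o) hk hreg hβ hS v
  have h0 := card_below_mul_limitOdds_nonneg (β := β) (hT := hT) (o := o) hk v
  refine (h.div (h.const_add 1) (by linarith)).congr' ?_
  filter_upwards [hS.eventually_mem v] with n hn
  have hq := childSum_pos (hT := hT) (o := o) (φ := exitOdds hT o (S n) β)
    (exitOdds_pos hβ (below_nonempty hk hreg)) (below_nonempty hk hreg v)
  rw [gasVertexProb, if_pos hn, coe_clampUnit (by positivity)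
    ((div_le_one (by positivity)).2 (by linarith))]
  rfl

theorem tendsto_gasChildLaw [MeasurableSpace V] [DiscreteMeasurableSpace V] (hk : 3 ≤ k)
    (hreg : T.IsRegularOfDegree k) (hβ : 0 < β) (hpos : 0 < limitOdds k β)
    (hS : IsExhaustion T S) {v : V} {e : T.edgeSet} (he : e ∈ below hT o v) :
    Tendsto (fun n => (gasChildLaw hT o (S n) (exitOdds hT o (S n) β) v).real {far T o e}) atTop
      (𝓝 ((uniformOn (children T o v)).real {far T o e})) := by
  classical
  have hc : 0 < ((below hT o v).card : ℝ) := by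
    exact_mod_cast Finset.card_pos.2 ⟨e, he⟩
  have hval : (uniformOn (children T o v)).real {far T o e} = 1 / (below hT o v).card := by
    have h1 : children T o v = (((below hT o v).image (far T o) : Finset V) : Set V) := by
      rw [children_eq_image hT, Finset.coe_image]
      congr 1
      ext e
      simp [edgesBelow]
    rw [measureReal_def, h1, ← Finset.coe_singleton, uniformOn_apply_finset,
      Finset.card_image_of_injective _ (far_injective hT o), Finset.inter_singleton_of_mem]
    · simp
    · exact Finset.mem_image_of_mem _ he
  rw [hval]
  have h := (tendsto_exitOdds (hT := hT) (o := o) hk hreg hβ hS e).div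
    (tendsto_childSum (hT := hT) (o := o) hk hreg hβ hS v) (mul_pos hc hpos).ne'
  rw [show (1 : ℝ) / (below hT o v).card = limitOdds k β / ((below hT o v).card * limitOdds k β) by
    field_simp]
  refine h.congr' ?_
  filter_upwards [hS.eventually_mem v] with n hn
  rw [gasChildLaw_real_singleton (exitOdds_pos hβ (below_nonempty hk hreg)) hn he]
  rfl

end ParameterConvergence

/-! ### Convergence of the superposed laws -/

section LawConvergence

variable {V : Type*} {T : SimpleGraph V} {o : V}
variable {p : ℕ → T.edgeSet → unitInterval} {p' : T.edgeSet → unitInterval}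
variable {r : ℕ → V → unitInterval} {r' : V → unitInterval}

theorem tendsto_edgeWeight (hp : ∀ e, Tendsto (fun n => (p n e : ℝ)) atTop (𝓝 (p' e)))
    (hr : ∀ v, Tendsto (fun n => (r n v : ℝ)) atTop (𝓝 (r' v))) (G : Finset T.edgeSet)
    (τ : Finset V) (b : Prop) (e : T.edgeSet) :
    Tendsto (fun n => edgeWeight T o (p n) (r n) G τ b e) atTop
      (𝓝 (edgeWeight T o p' r' G τ b e)) := by
  unfold edgeWeight
  split_ifs
  · exact tendsto_const_nhds
  · exact tendsto_const_nhds
  · exact tendsto_const_nhds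
  · exact hp e
  · exact ((hp e).const_sub 1).mul (hr _)
  · exact ((hp e).const_sub 1).mul ((hr _).const_sub 1)

theorem tendsto_rootWeight (hr : ∀ v, Tendsto (fun n => (r n v : ℝ)) atTop (𝓝 (r' v)))
    (τ : Finset V) : Tendsto (fun n => rootWeight o (r n) τ) atTop (𝓝 (rootWeight o r' τ)) := by
  unfold rootWeight
  split_ifs
  · exact hr o
  · exact (hr o).const_sub 1

variable [T.LocallyFinite] {hT : T.IsTree} [MeasurableSpace V] [DiscreteMeasurableSpace V]
  [Countable V] {ν : ℕ → V → Measure V} {ν' : V → Measure V} {S : Finset V}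

/-- The cylinder probabilities of the superposed configuration depend continuously on the
parameters. -/
theorem tendsto_superposedLaw_real_cylinderOn
    [∀ n v, IsProbabilityMeasure (ν n v)] [∀ v, IsProbabilityMeasure (ν' v)]
    (hc : ∀ n v, ∀ᵐ w ∂(ν n v), w ∈ children T o v) (hc' : ∀ v, ∀ᵐ w ∂(ν' v), w ∈ children T o v)
    (hp : ∀ e, Tendsto (fun n => (p n e : ℝ)) atTop (𝓝 (p' e)))
    (hr : ∀ v, Tendsto (fun n => (r n v : ℝ)) atTop (𝓝 (r' v)))
    (hν : ∀ v, ∀ e ∈ below hT o v,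
      Tendsto (fun n => (ν n v).real {far T o e}) atTop (𝓝 ((ν' v).real {far T o e})))
    (hS : IsRooted T o S) (G : Finset T.edgeSet) :
    Tendsto (fun n => (superposedLaw T o (p n) (r n) (ν n)).real (cylinderOn (edgesFrom hT o S) G))
      atTop (𝓝 ((superposedLaw T o p' r' ν').real (cylinderOn (edgesFrom hT o S) G))) := by
  rw [superposedLaw_real_cylinderOn _ _ _ hc' hS]
  refine Tendsto.congr
    (fun n => (superposedLaw_real_cylinderOn (p n) (r n) (ν n) (hc n) hS G).symm) ?_
  refine tendsto_finsetSum _ fun τ _ => (tendsto_rootWeight hr τ).mul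
    (tendsto_finsetProd _ fun u _ => tendsto_finsetSum _ fun e he => (hν u e he).mul
      (tendsto_finsetProd _ fun e' _ => tendsto_edgeWeight hp hr G τ _ e'))

theorem bondPercolation_real_cylinderOn {V : Type*} (T : SimpleGraph V) [DecidableEq T.edgeSet]
    (q : unitInterval) (A G : Finset T.edgeSet) :
    (bondPercolation T q).real (cylinderOn A G) =
      ∏ e ∈ A, if e ∈ G then (q : ℝ) else 1 - (q : ℝ) := by
  have : cylinderOn A G = Set.pi A fun e => {b | b = true ↔ e ∈ G} := rfl
  rw [bondPercolation, this, infinitePi_real_pi _ fun _ _ => MeasurableSet.of_discrete]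
  refine Finset.prod_congr rfl fun e _ => ?_
  by_cases he : e ∈ G
  · rw [if_pos he, ← bernoulli_real_true]
    congr 1
    ext b
    simp [he]
  · rw [if_neg he, ← bernoulli_real_false]
    congr 1
    ext b
    simp [he]

instance {V : Type*} (T : SimpleGraph V) (q : unitInterval) :
    IsProbabilityMeasure (bondPercolation T q) := by
  unfold bondPercolation
  infer_instance

/-- If the probabilities of `η` vanish in the limit, then the superposed configuration converges to
bond percolation, whatever the laws of the chosen children: the configurations for which no vertex
lies on a trail carry all the mass in the limit. -/
theorem tendsto_superposedLaw_real_cylinderOn_of_zero {q : unitInterval}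
    [∀ n v, IsProbabilityMeasure (ν n v)]
    (hc : ∀ n v, ∀ᵐ w ∂(ν n v), w ∈ children T o v)
    (hp : ∀ e, Tendsto (fun n => (p n e : ℝ)) atTop (𝓝 q))
    (hr : ∀ v, Tendsto (fun n => (r n v : ℝ)) atTop (𝓝 0))
    (hS : IsRooted T o S) {G : Finset T.edgeSet} (hG : G ⊆ edgesFrom hT o S) :
    Tendsto (fun n => (superposedLaw T o (p n) (r n) (ν n)).real (cylinderOn (edgesFrom hT o S) G))
      atTop (𝓝 ((bondPercolation T q).real (cylinderOn (edgesFrom hT o S) G))) := by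
  classical
  have hsum : ∀ n u, ∑ e ∈ below hT o u, (ν n u).real {far T o e} = 1 := by
    intro n u
    rw [← measureReal_biUnion_finset]
    · have h' : ν n u (children T o u) = 1 :=
        (mem_ae_iff_prob_eq_one MeasurableSet.of_discrete).1 (hc n u)
      have h : (⋃ e ∈ below hT o u, {far T o e}) = children T o u := by
        rw [children_eq_image hT]
        ext v
        simp [edgesBelow, eq_comm]
      rw [h, measureReal_def, h', ENNReal.toReal_one]
    · intro e _ e' _ hne
      exact Set.disjoint_singleton.2 fun h => hne (far_injective hT o h)
    · exact fun _ _ => MeasurableSet.of_discrete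
  have hprob : ∀ n, IsProbabilityMeasure (superposedLaw T o (p n) (r n) (ν n)) := fun n =>
    Measure.isProbabilityMeasure_map (measurable_superposition o).aemeasurable
  refine tendsto_of_le_of_sum_eq_one (A := (edgesFrom hT o S).powerset)
    (f := fun n G => (superposedLaw T o (p n) (r n) (ν n)).real (cylinderOn (edgesFrom hT o S) G))
    (g := fun n G => rootWeight o (r n) ∅ *
      ∏ u ∈ S, vertexWeight hT o (p n) (r n) (ν n) G ∅ u)
    (c := fun G => (bondPercolation T q).real (cylinderOn (edgesFrom hT o S) G))
    ?_ ?_ ?_ ?_ (Finset.mem_powerset.2 hG)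
  · refine Eventually.of_forall fun n G _ => ?_
    simp only [superposedLaw_real_cylinderOn (p n) (r n) (ν n) (hc n) hS G]
    refine Finset.single_le_sum (f := fun τ => rootWeight o (r n) τ *
      ∏ u ∈ S, vertexWeight hT o (p n) (r n) (ν n) G τ u) (fun τ _ => ?_)
      (Finset.mem_powerset.2 (Finset.empty_subset _))
    simp only [← seedLaw_real_agree (p n) (r n) (ν n) (hc n) hS G τ]
    exact measureReal_nonneg
  · exact fun n => real_cylinderOn_sum_powerset _ _
  · intro G _
    rw [bondPercolation_real_cylinderOn, prod_edgesFrom, ← one_mul (∏ u ∈ S, _)]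
    have h0 : Tendsto (fun n => rootWeight o (r n) ∅) atTop (𝓝 1) := by
      have h := (hr o).const_sub 1
      rw [sub_zero] at h
      simpa [rootWeight] using h
    refine h0.mul (tendsto_finsetProd _ fun u _ => ?_)
    simp only [vertexWeight_of_notMem (Finset.notMem_empty u), hsum, one_mul]
    refine tendsto_finsetProd _ fun e _ => ?_
    unfold edgeWeight
    simp only [Finset.notMem_empty, if_false]
    split_ifs
    · exact hp e
    · have h := ((hp e).const_sub 1).mul ((hr (far T o e)).const_sub 1)
      rwa [sub_zero, mul_one] at h
  · exact real_cylinderOn_sum_powerset _ _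

end LawConvergence

/-! ### The superposition without starting points -/

section NoStart

variable {V : Type*} {T : SimpleGraph V}

/-- If no vertex is in `η`, the superposed configuration is `ω₀`. -/
theorem superposedLaw_zero [MeasurableSpace V] [DiscreteMeasurableSpace V] [Countable V] (o : V)
    (q : unitInterval) {r : V → unitInterval} (hr : ∀ v, r v = 0) (ν : V → Measure V)
    [∀ v, IsProbabilityMeasure (ν v)] :
    superposedLaw T o (fun _ => q) r ν = bondPercolation T q := by
  have hη : ∀ᵐ η ∂(Measure.infinitePi fun v => bernoulliMeasure true false (r v)),
      ∀ v, η v = false := by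
    rw [ae_all_iff]
    intro v
    have h : ∀ᵐ b ∂(bernoulliMeasure true false (r v)), b = false := by
      rw [hr v, bernoulliMeasure_zero]
      exact (ae_dirac_iff MeasurableSet.of_discrete).2 rfl
    exact (measurePreserving_eval_infinitePi
      (fun v => bernoulliMeasure true false (r v)) v).quasiMeasurePreserving.ae h
  have hx : ∀ᵐ x ∂(seedLaw T (fun _ => q) r ν), superposition T o x.1 x.2.1 x.2.2 = x.1 := by
    have h := (Measure.quasiMeasurePreserving_snd (μ := bondPercolation T q)).ae
      ((Measure.quasiMeasurePreserving_fst (ν := Measure.infinitePi ν)).ae hη)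
    filter_upwards [h] with x hx
    funext e
    refine Bool.eq_iff_iff.2 ?_
    simp only [superposition, decide_eq_true_eq]
    refine ⟨?_, Or.inl⟩
    rintro (h | ⟨v, hv, -⟩)
    · exact h
    · have := hv.1
      rw [hx v] at this
      cases this
  rw [superposedLaw, Measure.map_congr hx]
  have : Measure.map Prod.fst (seedLaw T (fun _ => q) r ν) = bondPercolation T q := by
    rw [seedLaw, Measure.map_fst_prod, measure_univ, one_smul]
    rfl
  exact this

end NoStart

/-! ### Limits of the wired arboreal gas -/

section Limits

variable {V : Type*} {T : SimpleGraph V} [T.LocallyFinite] [Fact T.IsTree]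
variable {k : ℕ} {β : ℝ} {S : ℕ → Finset V}

/-- To identify the limit of the wired arboreal gas it suffices to find the limits of the cylinder
probabilities of the superposed configurations with the gas parameters. -/
theorem tendsto_wiredArborealGas_of_superposedLaw [MeasurableSpace V] [DiscreteMeasurableSpace V]
    [Countable V] {hT : T.IsTree} (o : V) (hk : 3 ≤ k) (hreg : T.IsRegularOfDegree k) (hβ : 0 < β)
    (hS : IsExhaustion T S) (W : ProbabilityMeasure (BondConfig T))
    (h : ∀ S₀, IsRooted T o S₀ → ∀ G ⊆ edgesFrom hT o S₀,
      Tendsto (fun n => (superposedLaw T o (gasEdgeProb hT o (S n) β (exitOdds hT o (S n) β))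
        (gasVertexProb hT o (S n) (exitOdds hT o (S n) β))
        (gasChildLaw hT o (S n) (exitOdds hT o (S n) β))).real (cylinderOn (edgesFrom hT o S₀) G))
        atTop (𝓝 ((W : Measure (BondConfig T)).real (cylinderOn (edgesFrom hT o S₀) G)))) :
    Tendsto (fun n => wiredArborealGas T (S n) β hβ) atTop (𝓝 W) := by
  refine tendsto_of_tendsto_cylinderOn fun A => ?_
  obtain ⟨m, hm, hmo⟩ := ((hS.eventually_subset (A := near T o '' (A : Set T.edgeSet))
    (A.finite_toSet.image _)).and (hS.eventually_mem o)).exists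
  have hroot : ∀ n, m ≤ n → IsRooted T o (S n) := fun n hn =>
    isRooted_of_connected hT (hS.monotone hn hmo) (hS.connected n)
  refine ⟨edgesFrom hT o (S m), fun e he => mem_edgesFrom.2 (hm _ ⟨e, he, rfl⟩), fun G hG => ?_⟩
  refine (h (S m) (hroot m le_rfl) G hG).congr' ?_
  filter_upwards [eventually_ge_atTop m] with n hn
  refine (wiredArborealGas_real_cylinderOn_eq_superposedLaw hβ (isExitOdds_exitOdds hβ (below_nonempty hk hreg))
    (below_nonempty hk hreg) (hroot n hn) (fun e he => ?_) G).symm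
  exact mem_edgesFrom.2 (hS.monotone hn (mem_edgesFrom.1 he))

/-- In the subcritical and critical regimes the limit of the wired arboreal gas is bond
percolation. -/
theorem tendsto_wiredArborealGas_bondPercolation (hk : 3 ≤ k) (hreg : T.IsRegularOfDegree k)
    (hβ : 0 < β) (hβc : β ≤ 1 / ((k : ℝ) - 2)) (hS : IsExhaustion T S) :
    Tendsto (fun n => wiredArborealGas T (S n) β hβ) atTop
      (𝓝 ⟨bondPercolation T (pArboreal β hβ), inferInstance⟩) := by
  have hT : T.IsTree := Fact.out
  obtain ⟨o⟩ := hT.connected.nonempty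
  let _ : MeasurableSpace V := ⊤
  have : DiscreteMeasurableSpace V := ⟨fun _ => trivial⟩
  have : Countable V := countable_vertices (T := T)
  have hk' : (3 : ℝ) ≤ k := by exact_mod_cast hk
  have h0 : limitOdds k β = 0 := by
    rw [le_div_iff₀ (by linarith)] at hβc
    rw [limitOdds, max_eq_left (by linarith), zero_div]
  have : ∀ n v, IsProbabilityMeasure (gasChildLaw hT o (S n) (exitOdds hT o (S n) β) v) :=
    fun n v => isProbabilityMeasure_gasChildLaw (exitOdds_pos hβ (below_nonempty hk hreg))
      (below_nonempty hk hreg v)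
  refine tendsto_wiredArborealGas_of_superposedLaw (hT := hT) o hk hreg hβ hS _
    fun S₀ hS₀ G hG => ?_
  refine tendsto_superposedLaw_real_cylinderOn_of_zero
    (fun n v => ae_mem_children_gasChildLaw (below_nonempty hk hreg v)) (fun e => ?_)
    (fun v => ?_) hS₀ hG
  · have h := tendsto_gasEdgeProb (hT := hT) (o := o) hk hreg hβ hS e
    rw [h0, mul_zero, add_zero, add_comm] at h
    exact h
  · have h := tendsto_gasVertexProb (hT := hT) (o := o) hk hreg hβ hS v
    rw [h0, mul_zero, zero_div] at h
    exact h

/-- The sampling procedure is the superposition with critical edge probabilities, the given vertex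
probabilities and uniform choices of children, for the discrete σ-algebra on `V`. -/
theorem sampledLaw_eq_superposedLaw (T : SimpleGraph V) (o : V) (hk : 3 ≤ k)
    (hβc : 1 / ((k : ℝ) - 2) ≤ β) :
    open Classical in sampledLaw T o k β hk hβc =
      @superposedLaw V T o ⊤ (fun _ => pCritical k hk)
        (fun v => if v = o then rootProb k β hk hβc else nonrootProb k β hk hβc)
        (fun v => @uniformOn V ⊤ (children T o v)) := rfl

theorem isProbabilityMeasure_sampledLaw (hk : 3 ≤ k) (hreg : T.IsRegularOfDegree k)
    (o : V) (hβc : 1 / ((k : ℝ) - 2) ≤ β) :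
    IsProbabilityMeasure (sampledLaw T o k β hk hβc) := by
  have hT : T.IsTree := Fact.out
  let _ : MeasurableSpace V := ⊤
  have : DiscreteMeasurableSpace V := ⟨fun _ => trivial⟩
  have : Countable V := countable_vertices (T := T)
  have : ∀ v, IsProbabilityMeasure (uniformOn (children T o v)) := fun v =>
    isProbabilityMeasure_uniformOn (finite_children o v)
      (children_nonempty (hT := hT) (below_nonempty hk hreg v))
  rw [sampledLaw_eq_superposedLaw]
  exact Measure.isProbabilityMeasure_map (measurable_superposition o).aemeasurable

/-- In the supercritical regime the limit of the wired arboreal gas is the law of the configuration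
produced by the sampling procedure. -/
theorem tendsto_wiredArborealGas_sampledLaw (hk : 3 ≤ k) (hreg : T.IsRegularOfDegree k)
    (hβ : 0 < β) (hβc : 1 / ((k : ℝ) - 2) < β) (hS : IsExhaustion T S) (o : V) :
    Tendsto (fun n => wiredArborealGas T (S n) β hβ) atTop
      (𝓝 ⟨sampledLaw T o k β hk hβc.le, isProbabilityMeasure_sampledLaw hk hreg o hβc.le⟩) := by
  classical
  have hT : T.IsTree := Fact.out
  let _ : MeasurableSpace V := ⊤
  have : DiscreteMeasurableSpace V := ⟨fun _ => trivial⟩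
  have : Countable V := countable_vertices (T := T)
  have hk' : (3 : ℝ) ≤ k := by exact_mod_cast hk
  have hb := below_nonempty (hT := hT) (o := o) hk hreg
  have h1 : 0 < ((k : ℝ) - 2) * β - 1 := by
    rw [div_lt_iff₀ (by linarith)] at hβc
    linarith
  have hmul : ((k : ℝ) - 1) * limitOdds k β = ((k : ℝ) - 2) * β - 1 := by
    rw [mul_limitOdds hk, max_eq_right h1.le]
  have hpos : 0 < limitOdds k β := by
    rw [limitOdds, max_eq_right h1.le]
    exact div_pos h1 (by linarith)
  have hdef : limitOdds k β = (((k : ℝ) - 2) * β - 1) / ((k : ℝ) - 1) := by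
    rw [limitOdds, max_eq_right h1.le]
  have : ∀ n v, IsProbabilityMeasure (gasChildLaw hT o (S n) (exitOdds hT o (S n) β) v) :=
    fun n v => isProbabilityMeasure_gasChildLaw (exitOdds_pos hβ hb) (hb v)
  have : ∀ v, IsProbabilityMeasure (uniformOn (children T o v)) := fun v =>
    isProbabilityMeasure_uniformOn (finite_children o v) (children_nonempty (hb v))
  refine tendsto_wiredArborealGas_of_superposedLaw (hT := hT) o hk hreg hβ hS _
    fun S₀ hS₀ G hG => ?_
  change Tendsto _ _ (𝓝 ((sampledLaw T o k β hk hβc.le).real _))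
  rw [sampledLaw_eq_superposedLaw]
  refine tendsto_superposedLaw_real_cylinderOn
    (fun n v => ae_mem_children_gasChildLaw (hb v)) (fun v => ae_mem_children_uniformOn (hb v))
    (fun e => ?_) (fun v => ?_) (fun v e he => tendsto_gasChildLaw hk hreg hβ hpos hS he) hS₀ G
  · have h := tendsto_gasEdgeProb (hT := hT) (o := o) hk hreg hβ hS e
    rw [hmul] at h
    convert h using 2
    change 1 / ((k : ℝ) - 1) = _
    rw [div_eq_div_iff (by linarith) (by nlinarith)]
    ring
  · have h := tendsto_gasVertexProb (hT := hT) (o := o) hk hreg hβ hS v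
    convert h using 2
    by_cases hv : v = o
    · subst hv
      rw [if_pos rfl, card_below_root hreg, hdef]
      change (β * ((k : ℝ) - 2) * k - k) / (β * ((k : ℝ) - 2) * k - 1) = _
      have h2 : (0 : ℝ) < β * ((k : ℝ) - 2) * k - 1 := by nlinarith
      have h3 : (k : ℝ) - 1 ≠ 0 := by linarith
      have h4 : 0 ≤ (k : ℝ) * ((((k : ℝ) - 2) * β - 1) / ((k : ℝ) - 1)) :=
        mul_nonneg (by linarith) (div_nonneg h1.le (by linarith))
      rw [div_eq_div_iff h2.ne' (by linarith)]
      field_simp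
      ring
    · obtain ⟨e, rfl⟩ := exists_far_eq hT hv
      rw [if_neg hv, card_below_far hreg, Nat.cast_sub (by omega), Nat.cast_one, hmul]
      change (β * ((k : ℝ) - 2) - 1) / (β * ((k : ℝ) - 2)) = _
      rw [div_eq_div_iff (by nlinarith) (by linarith)]
      ring

/-- At `β = 1 / (k - 2)` both vertex probabilities vanish and `p_c = p_β`, so the sampling procedure
produces bond percolation. -/
theorem sampledLaw_critical (hk : 3 ≤ k) (hreg : T.IsRegularOfDegree k) (hβ : 0 < β)
    (hβc : 1 / ((k : ℝ) - 2) ≤ β) (heq : β = 1 / ((k : ℝ) - 2)) (o : V) :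
    sampledLaw T o k β hk hβc = bondPercolation T (pArboreal β hβ) := by
  classical
  have hT : T.IsTree := Fact.out
  let _ : MeasurableSpace V := ⊤
  have : DiscreteMeasurableSpace V := ⟨fun _ => trivial⟩
  have : Countable V := countable_vertices (T := T)
  have hk' : (3 : ℝ) ≤ k := by exact_mod_cast hk
  have : ∀ v, IsProbabilityMeasure (uniformOn (children T o v)) := fun v =>
    isProbabilityMeasure_uniformOn (finite_children o v)
      (children_nonempty (hT := hT) (below_nonempty hk hreg v))
  have h1 : β * ((k : ℝ) - 2) = 1 := by
    rw [heq, one_div, inv_mul_cancel₀ (by linarith)]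
  have hp : pCritical k hk = pArboreal β hβ := by
    refine Subtype.ext ?_
    change 1 / ((k : ℝ) - 1) = β / (β + 1)
    rw [div_eq_div_iff (by linarith) (by linarith)]
    linarith
  rw [sampledLaw_eq_superposedLaw, superposedLaw_zero, hp]
  intro v
  refine Subtype.ext ?_
  split_ifs
  · change (β * ((k : ℝ) - 2) * k - k) / (β * ((k : ℝ) - 2) * k - 1) = 0
    rw [h1, one_mul, sub_self, zero_div]
  · change (β * ((k : ℝ) - 2) - 1) / (β * ((k : ℝ) - 2)) = 0
    rw [h1, sub_self, zero_div]

end Limits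

/-! ### Automorphisms -/

section Automorphisms

variable {V : Type*} {T : SimpleGraph V}

theorem isLink_wiredGraph_map (φ : T ≃g T) {S S' : Finset V} (hS : ∀ v, φ v ∈ S' ↔ v ∈ S)
    {e : T.edgeSet} {a b : Option V} (h : (wiredGraph T S).IsLink e a b) :
    (wiredGraph T S').IsLink (φ.mapEdgeSet e) (a.map φ) (b.map φ) := by
  classical
  have hW : ∀ v ∈ withNeighbours T S, φ v ∈ withNeighbours T S' := by
    rintro v (h | ⟨u, hu, hadj⟩)
    · exact Or.inl ((hS v).2 h)
    · exact Or.inr ⟨φ u, (hS u).2 hu, φ.map_adj_iff.2 hadj⟩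
  have hw : ∀ v, (wireVertex S v).map φ = wireVertex S' (φ v) := by
    intro v
    by_cases hv : v ∈ S
    · rw [wireVertex_of_mem hv, wireVertex_of_mem ((hS v).2 hv), Option.map_some]
    · rw [wireVertex_of_notMem hv, wireVertex_of_notMem (fun h => hv ((hS v).1 h)),
        Option.map_none]
  obtain ⟨x, y, ⟨he, hx, hy⟩, rfl, rfl⟩ := h
  refine ⟨φ x, φ y, ⟨?_, hW x hx, hW y hy⟩, (hw x).symm, (hw y).symm⟩
  change Sym2.map φ (e : Sym2 V) = _
  rw [he, Sym2.map_mk]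

theorem isForest_of_map (φ : T ≃g T) {S S' : Finset V} (hS : ∀ v, φ v ∈ S' ↔ v ∈ S)
    {F : Set T.edgeSet} (h : (wiredGraph T S').IsForest (φ.mapEdgeSet '' F)) :
    (wiredGraph T S).IsForest F := by
  refine ⟨fun e he => ?_, ?_⟩
  · have h1 := h.1 ⟨e, he, rfl⟩
    obtain ⟨a, b, hab⟩ := ((wiredGraph T S').edge_mem_iff_exists_isLink _).1 h1
    have h2 := isLink_wiredGraph_map φ.symm (S := S') (S' := S)
      (fun v => by rw [← hS, φ.apply_symm_apply]) hab
    have h3 : φ.symm.mapEdgeSet (φ.mapEdgeSet e) = e := φ.mapEdgeSet.symm_apply_apply e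
    rw [h3] at h2
    exact ((wiredGraph T S).edge_mem_iff_exists_isLink _).2 ⟨_, _, h2⟩
  · rintro ⟨m, v, e, hv, he, hl⟩
    exact h.2 ⟨m, fun i => (v i).map φ, fun i => φ.mapEdgeSet (e i),
      (Option.map_injective φ.injective).comp hv, φ.mapEdgeSet.injective.comp he,
      fun i => ⟨⟨e i, (hl i).1, rfl⟩, isLink_wiredGraph_map φ hS (hl i).2⟩⟩

/-- Automorphisms of `T` induce isomorphisms of wired graphs. -/
theorem isForest_map_iff (φ : T ≃g T) {S S' : Finset V} (hS : ∀ v, φ v ∈ S' ↔ v ∈ S)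
    {F : Set T.edgeSet} :
    (wiredGraph T S').IsForest (φ.mapEdgeSet '' F) ↔ (wiredGraph T S).IsForest F := by
  refine ⟨isForest_of_map φ hS, fun h => isForest_of_map φ.symm (S := S') (S' := S)
    (fun v => by rw [← hS, φ.apply_symm_apply]) ?_⟩
  have : φ.symm.mapEdgeSet '' (φ.mapEdgeSet '' F) = F := φ.mapEdgeSet.symm_image_image F
  rwa [this]

theorem mem_forests_iff {α ε : Type*} {G : Graph α ε} (hG : G.edgeSet.Finite) {F : Finset ε} :
    F ∈ G.forests hG ↔ G.IsForest (F : Set ε) := by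
  classical
  rw [Graph.forests, Finset.mem_filter, and_iff_right_iff_imp, Finset.mem_powerset]
  exact fun h e he => hG.mem_toFinset.2 (h.1 he)

theorem continuous_relabel (φ : T ≃g T) : Continuous (relabel φ) :=
  continuous_pi fun _ => continuous_apply _

theorem measurable_relabel (φ : T ≃g T) : Measurable (relabel φ) :=
  measurable_pi_lambda _ fun _ => measurable_pi_apply _

theorem dist_map_le (hT : T.IsTree) (φ : T ≃g T) (u v : V) : T.dist (φ u) (φ v) ≤ T.dist u v := by
  obtain ⟨p, hp⟩ := hT.connected.exists_walk_length_eq_dist u v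
  have h := T.dist_le (p.map (φ : T →g T))
  rw [SimpleGraph.Walk.length_map, hp] at h
  exact h

variable [T.LocallyFinite]

/-- An automorphism of `T` transports the arboreal gas of `S` to that of the image of `S`. -/
theorem map_relabel_wiredArborealGas (φ : T ≃g T) {S S' : Finset V}
    (hS : ∀ v, φ v ∈ S' ↔ v ∈ S) {β : ℝ} (hβ : 0 < β) :
    Measure.map (relabel φ) (wiredArborealGas T S β hβ : Measure (BondConfig T)) =
      wiredArborealGas T S' β hβ := by
  classical
  have hforest : ∀ F, F ∈ (wiredGraph T S).forests (finite_edgeSet_wiredGraph T S) ↔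
      φ.mapEdgeSet.finsetCongr F ∈ (wiredGraph T S').forests (finite_edgeSet_wiredGraph T S') := by
    intro F
    rw [mem_forests_iff, mem_forests_iff, ← isForest_map_iff φ hS]
    simp [Equiv.finsetCongr_apply]
  have hcard : ∀ F, (φ.mapEdgeSet.finsetCongr F).card = F.card := fun F => by
    rw [Equiv.finsetCongr_apply, Finset.card_map]
  have hZ : (wiredGraph T S).arborealPartition (finite_edgeSet_wiredGraph T S) β =
      (wiredGraph T S').arborealPartition (finite_edgeSet_wiredGraph T S') β :=
    Finset.sum_equiv φ.mapEdgeSet.finsetCongr hforest fun F _ => by rw [hcard]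
  change Measure.map (relabel φ) ((wiredGraph T S).arborealMeasure _ β) =
    (wiredGraph T S').arborealMeasure _ β
  ext A hA
  rw [Measure.map_apply (measurable_relabel φ) hA, Graph.arborealMeasure, Graph.arborealMeasure]
  simp only [Measure.coe_finsetSum, Finset.sum_apply, Measure.smul_apply, smul_eq_mul]
  refine Finset.sum_equiv φ.mapEdgeSet.finsetCongr hforest fun F _ => ?_
  have hconf : relabel φ (fun e => decide (e ∈ F)) =
      fun e => decide (e ∈ φ.mapEdgeSet.finsetCongr F) := by
    funext e
    change decide (φ.symm.mapEdgeSet e ∈ F) = _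
    refine decide_eq_decide.2 ?_
    rw [Equiv.finsetCongr_apply, Finset.mem_map_equiv]
    rfl
  have hdirac : (Measure.dirac fun e => decide (e ∈ F)) (relabel φ ⁻¹' A) =
      (Measure.dirac fun e => decide (e ∈ φ.mapEdgeSet.finsetCongr F)) A := by
    rw [Measure.dirac_apply' _ (measurable_relabel φ hA), Measure.dirac_apply' _ hA, ← hconf]
    rfl
  rw [hcard, hZ]
  congr 1
  convert hdirac

end Automorphisms

/-! ### Balls and invariance of the limit -/

section Balls

variable {V : Type*} {T : SimpleGraph V} [T.LocallyFinite]

/-- The ball of radius `n` around `o`. -/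
def ballFinset (hT : T.IsTree) (o : V) (n : ℕ) : Finset V := (finite_dist_le hT o n).toFinset

theorem mem_ballFinset {hT : T.IsTree} {o v : V} {n : ℕ} :
    v ∈ ballFinset hT o n ↔ T.dist o v ≤ n := by
  simp [ballFinset]

theorem isExhaustion_ballFinset (hT : T.IsTree) (o : V) : IsExhaustion T (ballFinset hT o) where
  monotone m n hmn v hv := mem_ballFinset.2 ((mem_ballFinset.1 hv).trans hmn)
  exhausts v := ⟨T.dist o v, mem_ballFinset.2 le_rfl⟩
  connected n := by
    have ho : o ∈ ballFinset hT o n := mem_ballFinset.2 (by simp)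
    have key : ∀ m v (hv : v ∈ ballFinset hT o n), T.dist o v = m →
        (T.induce (ballFinset hT o n : Set V)).Reachable ⟨o, ho⟩ ⟨v, hv⟩ := by
      intro m
      induction m with
      | zero =>
        intro v hv hd
        obtain rfl := hT.connected.dist_eq_zero_iff.1 hd
        rfl
      | succ m ih =>
        intro v hv hd
        obtain ⟨e, rfl⟩ := exists_far_eq hT (o := o) (v := v) (by rintro rfl; simp at hd)
        have h1 := dist_far hT o e
        have h2 := mem_ballFinset.1 hv
        refine (ih (near T o e) (mem_ballFinset.2 (by omega)) (by omega)).trans ?_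
        exact SimpleGraph.Adj.reachable (adj_near_far hT o e)
    have : Nonempty (ballFinset hT o n : Set V) := ⟨⟨o, ho⟩⟩
    exact ⟨fun u v => (key _ u.1 u.2 rfl).symm.trans (key _ v.1 v.2 rfl)⟩

theorem mem_ballFinset_map (hT : T.IsTree) (φ : T ≃g T) (o v : V) (n : ℕ) :
    φ v ∈ ballFinset hT (φ o) n ↔ v ∈ ballFinset hT o n := by
  rw [mem_ballFinset, mem_ballFinset]
  have h := dist_map_le hT φ.symm (φ o) (φ v)
  rw [φ.symm_apply_apply, φ.symm_apply_apply] at h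
  exact ⟨fun h' => h.trans h', fun h' => (dist_map_le hT φ o v).trans h'⟩

/-- A common limit of the wired arboreal gas along all exhaustions is invariant under automorphisms,
because an automorphism maps the balls around `o` to the balls around the image of `o`. -/
theorem map_relabel_eq_of_tendsto [Fact T.IsTree] {β : ℝ} (hβ : 0 < β)
    {W : ProbabilityMeasure (BondConfig T)}
    (hW : ∀ S : ℕ → Finset V, IsExhaustion T S →
      Tendsto (fun n => wiredArborealGas T (S n) β hβ) atTop (𝓝 W)) (φ : T ≃g T) :
    Measure.map (relabel φ) (W : Measure (BondConfig T)) = W := by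
  have hT : T.IsTree := Fact.out
  obtain ⟨o⟩ := hT.connected.nonempty
  have h1 := hW _ (isExhaustion_ballFinset hT o)
  have h2 := hW _ (isExhaustion_ballFinset hT (φ o))
  have h3 := ProbabilityMeasure.tendsto_map_of_tendsto_of_continuous _ _ h1 (continuous_relabel φ)
  have h4 : ∀ n, (wiredArborealGas T (ballFinset hT o n) β hβ).map
      (continuous_relabel φ).measurable.aemeasurable =
      wiredArborealGas T (ballFinset hT (φ o) n) β hβ := fun n =>
    Subtype.ext (map_relabel_wiredArborealGas φ (fun v => mem_ballFinset_map hT φ o v n) hβ)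
  simp only [h4] at h3
  have h5 := tendsto_nhds_unique h3 h2
  exact congrArg (fun μ : ProbabilityMeasure (BondConfig T) => (μ : Measure (BondConfig T))) h5

end Balls

end

/-! ### The limit of the arboreal gas -/

theorem theorem1 {V : Type*} (T : SimpleGraph V) [T.LocallyFinite] [Fact T.IsTree]
    (k : ℕ) (hk : 3 ≤ k) (hreg : T.IsRegularOfDegree k) (β : ℝ) (hβ : 0 < β) :
    ∃ W : ProbabilityMeasure (BondConfig T),
      (∀ S : ℕ → Finset V, IsExhaustion T S →
        Tendsto (fun n => wiredArborealGas T (S n) β hβ) atTop (𝓝 W)) ∧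
      (∀ φ : T ≃g T, Measure.map (relabel φ) (W : Measure (BondConfig T)) = W) ∧
      (β ≤ 1 / ((k : ℝ) - 2) →
        (W : Measure (BondConfig T)) = bondPercolation T (pArboreal β hβ)) ∧
      (∀ hβc : 1 / ((k : ℝ) - 2) ≤ β, ∀ o : V,
        (W : Measure (BondConfig T)) = sampledLaw T o k β hk hβc) := by
  rcases le_or_gt β (1 / ((k : ℝ) - 2)) with hle | hlt
  · have hW := fun (S : ℕ → Finset V) hS =>
      tendsto_wiredArborealGas_bondPercolation (S := S) hk hreg hβ hle hS
    refine ⟨_, hW, map_relabel_eq_of_tendsto hβ hW, fun _ => rfl, fun hβc o => ?_⟩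
    -- only the critical value of `β` belongs to both regimes
    exact (sampledLaw_critical hk hreg hβ hβc (le_antisymm hle hβc) o).symm
  · have hT : T.IsTree := Fact.out
    obtain ⟨o⟩ := hT.connected.nonempty
    have hW := fun (S : ℕ → Finset V) hS =>
      tendsto_wiredArborealGas_sampledLaw (S := S) hk hreg hβ hlt hS o
    refine ⟨_, hW, map_relabel_eq_of_tendsto hβ hW, fun h => absurd h hlt.not_ge,
      fun hβc o' => ?_⟩
    -- the law for the root `o'` is a limit along the same exhaustion
    have hS := isExhaustion_ballFinset hT o
    have h := tendsto_nhds_unique (hW _ hS)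
      (tendsto_wiredArborealGas_sampledLaw hk hreg hβ hlt hS o')
    exact congrArg (fun μ : ProbabilityMeasure (BondConfig T) => (μ : Measure (BondConfig T))) h
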